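/- Let $t\ge 0$ be an integer and let $\sigma=\sigma_t$ be the substitution on $\mathcal A=\{1,\dots,5\}$ given by $$1\mapsto 1^{t+1}2,\quad 2\mapsto 3,\quad 3\mapsto 4,\quad 4\mapsto 1^t5,\quad 5\mapsto 1.$$ Let $M=(|\sigma(a)|_b)_{b,a}$ be its incidence matrix, $\mathbf l$ the abelianization of words, and write $\mathbf l(\underline a)=\mathbf e_{a_1}+\dots+\mathbf e_{a_k}$ for $\underline a=a_1\wedge\dots\wedge a_k$. Then $\sigma$ is a reducible primitive unit Pisot substitution whose Pisot root $\beta$ has degree $3$: $M$ is primitive, and its dominant eigenvalue is simple and is a Pisot number $\beta$ of degree $3$ and norm $\pm1$. Moreover $\sigma$ is a nice reducible substitution, in the following sense. *Notation.* Let $f$ be the minimal polynomial of $\beta$ over $\mathbb Q$ and $g=\det(xI-M)/f$ the neutral polynomial; reducible means $g\ne1$. Then $\mathbb R^5=\mathbb K_e\oplus\mathbb K_c\oplus\mathbb K_n$, where $\mathbb K_e$ is the eigenline of $\beta$, $\mathbb K_c$ is the real $M$-invariant plane belonging to the Galois conjugates of $\beta$ other than $\beta$, and $\mathbb K_n=f(M)\mathbb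 R^5$; let $\pi_e,\pi_c$ be the projections onto $\mathbb K_e,\mathbb K_c$ along the other two summands. Let $\mathcal O_k$ be the set of $\underline a=a_1\wedge\dots\wedge a_k$ with letters $a_1<\dots<a_k$, and $C_k$ the free abelian group on the faces $(\mathbf x,\underline a)\in\mathbb Z^5\times\mathcal O_k$. For arbitrary letters $(\mathbf x,\cdot)$ is extended antisymmetrically, with value $0$ if two letters agree. Let $\{P\}$ be the set of faces with non-zero coefficient in $P\in C_k$. The support of $(\mathbf x,\underline a)$ is $\{\mathbf x+\sum_i t_i\mathbf e_{a_i}:t_i\in[0,1]\}$. An element $P\in C_k$ is geometric if its non-zero coefficients are all $\pm1$; a geometric $P$ projects well if the $\pi_c$-images of the supports of any two distinct faces of $P$ have disjoint interiors in $\mathbb K_c$. Let $C_3^*$ be the free abelian group on the dual faces $(\mathbf x,\underline a)^*$, $(\mathbf x,\underline a)\in\mathbb Z^5\times\mathcal O_3$, and let $\mathbf E_3^*(\sigma)$ be the endomorphism of $C_3^*$ dual to $$\mathbf E_3(\sigma)(\mathbf x,\underline a)=\sum(M\mathbf x+\mathbf l(p_1p_2p_3),\,b_1\wedge b_2\wedge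 b_3),$$ where the sum is over all decompositions $\sigma(a_i)=p_ib_is_i$, $i=1,2,3$, with $b_i$ a letter. Thus $\mathbf E_3^*(\sigma)(\mathbf x,\underline a)^*=\sum\operatorname{sgn}(\tau)\,(M^{-1}(\mathbf x-\mathbf l(p_1p_2p_3)),\underline b)^*$, the sum being over $\underline b\in\mathcal O_3$, permutations $\tau$ of $\{1,2,3\}$ and decompositions $\sigma(b_i)=p_ia_{\tau(i)}s_i$. Let $\varphi:C_3^*\to C_2$ be the isomorphism $$\varphi\big((\mathbf x,\underline a)^*\big)=(-1)^{a_1+a_2+a_3}(\mathbf x+\mathbf l(\underline a),\underline a^*),$$ where $\underline a^*\in\mathcal O_2$ is formed by the two letters not in $\underline a$, and put $\mathbf E^2(\sigma)=\varphi\circ\mathbf E_3^*(\sigma)\circ\varphi^{-1}$. Finally let $\mathcal S$ be the set of faces appearing in some $\varphi((\mathbf x,\underline a)^*)$ with $\pi_e(\mathbf x)\in[-\pi_e(\mathbf l(\underline a)),\mathbf 0)$, where $[\mathbf z_1,\mathbf z_2)=\{(1-s)\mathbf z_1+s\mathbf z_2:s\in[0,1)\}$. *Claim.* The following hold. * (S1)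 For every $U\in\mathcal S$, $\mathbf E^2(\sigma)(U)$ is geometric and projects well. * (S2) For any two distinct $U_1,U_2\in\mathcal S$ such that $U_1+U_2$ projects well, the sets $\{\mathbf E^2(\sigma)(U_1)\}$ and $\{\mathbf E^2(\sigma)(U_2)\}$ are disjoint, and $\mathbf E^2(\sigma)(U_1+U_2)$ projects well. * (P) For every $(\mathbf x,\underline a)\in\mathbb Z^5\times\mathcal O_3$, all coefficients of $\mathbf E_3^*(\sigma)(\mathbf x,\underline a)^*$ are non-negative; and the matrix $\bigwedge^3\,{}^tM$ of the minors of order $3$ of ${}^tM$ is primitive. * (N) All complex roots of $g$ are simple and of modulus one, and $g(0)=1$. -/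

import Mathlib

open Polynomial

noncomputable section

namespace PisotDual

/-! ### Substitutions -/

/-- A substitution on the alphabet `{1, …, n}`, given by the non-empty images of the letters.
The letter `i` of the alphabet is represented by the element `i - 1` of `Fin n`. -/
structure Substitution (n : ℕ) where
  img : Fin n → List (Fin n)
  img_ne_nil : ∀ a, img a ≠ []

variable {n k j : ℕ}

/-- Abelianization of a word. -/
def abel (w : List (Fin n)) : Fin n → ℤ := fun b => (w.count b : ℤ)

namespace Substitution

/-- The incidence matrix: the entry `(b, a)` is the number of letters `b` in `σ(a)`. -/
def incidence (σ : Substitution n) : Matrix (Fin n) (Fin n) ℤ :=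
  Matrix.of fun b a => ((σ.img a).count b : ℤ)

/-- The incidence matrix as an endomorphism of `ℝⁿ`. -/
def action (σ : Substitution n) : Module.End ℝ (Fin n → ℝ) :=
  Matrix.toLin' (σ.incidence.map (Int.cast : ℤ → ℝ))

/-- The characteristic polynomial of the incidence matrix, over `ℚ`. -/
def charPoly (σ : Substitution n) : ℚ[X] :=
  σ.incidence.charpoly.map (Int.castRingHom ℚ)

/-- `σ` is a primitive unit Pisot substitution with Pisot root `β`: the incidence matrix is
primitive, its dominant (simple) eigenvalue is `β`, and `β` is a Pisot number and a unit. The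
norm of `β` is, up to sign, the constant coefficient of its minimal polynomial. -/
structure IsPrimitiveUnitPisot (σ : Substitution n) (β : ℝ) : Prop where
  primitive : σ.incidence.IsPrimitive
  isIntegral : IsIntegral ℤ β
  one_lt : 1 < β
  conj_lt_one : ∀ z : ℂ, aeval z (minpoly ℚ β) = 0 → z ≠ (β : ℂ) → ‖z‖ < 1
  norm_unit : |(minpoly ℚ β).coeff 0| = 1
  eigenvalue_simple : (σ.charPoly.map (algebraMap ℚ ℝ)).rootMultiplicity β = 1
  dominant : ∀ z : ℂ, aeval z σ.charPoly = 0 → z ≠ (β : ℂ) → ‖z‖ < β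

end Substitution

/-- The neutral polynomial `g`: the characteristic polynomial is `f g`, where `f` is the minimal
polynomial of `β`. -/
def neutralPoly (σ : Substitution n) (β : ℝ) : ℚ[X] :=
  σ.charPoly /ₘ minpoly ℚ β

/-- `σ` is reducible: the neutral polynomial is not `1`. -/
def IsReducible (σ : Substitution n) (β : ℝ) : Prop := neutralPoly σ β ≠ 1

/-! ### The representation space -/

/-- The minimal polynomial of `β`, over `ℝ`. -/
def pisotPolyReal (β : ℝ) : ℝ[X] := (minpoly ℚ β).map (algebraMap ℚ ℝ)

/-- The product of the `X - β'` over the Galois conjugates `β' ≠ β` of `β`. -/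
def contractingPoly (β : ℝ) : ℝ[X] := pisotPolyReal β /ₘ (X - C β)

/-- The expanding line: the eigenspace of `β`. -/
def Ke (σ : Substitution n) (β : ℝ) : Submodule ℝ (Fin n → ℝ) :=
  LinearMap.ker (aeval σ.action (X - C β))

/-- The contracting space: the real invariant subspace which is the sum of the eigenspaces of
the Galois conjugates of `β` other than `β`. -/
def Kc (σ : Substitution n) (β : ℝ) : Submodule ℝ (Fin n → ℝ) :=
  LinearMap.ker (aeval σ.action (contractingPoly β))

/-- The neutral space `f(M) ℝⁿ`. -/
def Kn (σ : Substitution n) (β : ℝ) : Submodule ℝ (Fin n → ℝ) :=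
  LinearMap.range (aeval σ.action (pisotPolyReal β))

theorem isCompl_aux {V : Type*} [AddCommGroup V] [Module ℝ V] (M : Module.End ℝ V)
    (A B G : ℝ[X]) (hAB : IsCoprime A B) (hAG : IsCoprime A G) (hBG : IsCoprime B G)
    (h0 : aeval M (A * B * G) = 0) :
    IsCompl (LinearMap.ker (aeval M A))
      (LinearMap.ker (aeval M B) ⊔ LinearMap.range (aeval M (A * B))) := by
  have hr : LinearMap.range (aeval M (A * B)) = LinearMap.ker (aeval M G) := by
    apply le_antisymm
    · rintro _ ⟨x, rfl⟩
      rw [LinearMap.mem_ker, ← Module.End.mul_apply, ← map_mul, mul_comm, h0]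
      rfl
    · intro x hx
      obtain ⟨u, v, huv⟩ := IsCoprime.mul_left hAG hBG
      refine ⟨aeval M u x, ?_⟩
      have h1 : aeval M (u * (A * B) + v * G) x = x := by rw [huv]; simp
      rw [map_add, LinearMap.add_apply, map_mul (aeval M) v G, Module.End.mul_apply,
        LinearMap.mem_ker.mp hx, map_zero, add_zero, mul_comm, map_mul,
        Module.End.mul_apply] at h1
      exact h1
  rw [hr, Polynomial.sup_ker_aeval_eq_ker_aeval_mul_of_coprime M hBG]
  have hc : IsCoprime A (B * G) := IsCoprime.mul_right hAB hAG
  refine ⟨Polynomial.disjoint_ker_aeval_of_isCoprime M hc, ?_⟩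
  rw [codisjoint_iff, Polynomial.sup_ker_aeval_eq_ker_aeval_mul_of_coprime M hc, ← mul_assoc, h0]
  exact LinearMap.ker_zero

namespace Substitution.IsPrimitiveUnitPisot

variable {σ : Substitution n} {β : ℝ}

theorem charPoly_eq (h : σ.IsPrimitiveUnitPisot β) :
    σ.charPoly = minpoly ℚ β * neutralPoly σ β := by
  have hi : IsIntegral ℚ β := h.isIntegral.tower_top
  have h1 : (σ.charPoly.map (algebraMap ℚ ℝ)).IsRoot β := by
    have := h.eigenvalue_simple
    by_contra hn
    rw [rootMultiplicity_eq_zero hn] at this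
    exact zero_ne_one this
  have hd : minpoly ℚ β ∣ σ.charPoly :=
    minpoly.dvd ℚ β (by rwa [IsRoot.def, eval_map_algebraMap] at h1)
  have := modByMonic_add_div σ.charPoly (minpoly ℚ β)
  rw [(modByMonic_eq_zero_iff_dvd (minpoly.monic hi)).mpr hd, zero_add] at this
  exact this.symm

theorem pisotPoly_eq (_ : σ.IsPrimitiveUnitPisot β) :
    pisotPolyReal β = (X - C β) * contractingPoly β := by
  have : (pisotPolyReal β).IsRoot β := by
    rw [IsRoot.def, pisotPolyReal, eval_map_algebraMap, minpoly.aeval]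
  exact (mul_divByMonic_eq_iff_isRoot.mpr this).symm

theorem coprimes (h : σ.IsPrimitiveUnitPisot β) :
    IsCoprime (X - C β) (contractingPoly β) ∧
    IsCoprime (X - C β) ((neutralPoly σ β).map (algebraMap ℚ ℝ)) ∧
    IsCoprime (contractingPoly β) ((neutralPoly σ β).map (algebraMap ℚ ℝ)) := by
  have hi : IsIntegral ℚ β := h.isIntegral.tower_top
  set G := (neutralPoly σ β).map (algebraMap ℚ ℝ) with hG
  have hχ : σ.charPoly.map (algebraMap ℚ ℝ) = (X - C β) * (contractingPoly β * G) := by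
    rw [h.charPoly_eq, Polynomial.map_mul, ← mul_assoc, ← h.pisotPoly_eq]
    rfl
  have hχ0 : σ.charPoly.map (algebraMap ℚ ℝ) ≠ 0 := by
    intro h0
    have := h.eigenvalue_simple
    rw [h0, rootMultiplicity_zero] at this
    exact zero_ne_one this
  have hnd : ¬ (X - C β) ∣ contractingPoly β * G := by
    rintro ⟨r, hr⟩
    have h2 : 2 ≤ (σ.charPoly.map (algebraMap ℚ ℝ)).rootMultiplicity β := by
      rw [le_rootMultiplicity_iff hχ0]
      exact ⟨r, by rw [hχ, hr]; ring⟩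
    rw [h.eigenvalue_simple] at h2
    omega
  have hc : IsCoprime (X - C β) (contractingPoly β * G) :=
    ((irreducible_X_sub_C β).coprime_iff_not_dvd).mpr hnd
  have hfg : IsCoprime (minpoly ℚ β) (neutralPoly σ β) := by
    refine ((minpoly.irreducible hi).coprime_iff_not_dvd).mpr fun hdv => hnd ?_
    refine Dvd.dvd.mul_left ?_ _
    rw [dvd_iff_isRoot, IsRoot.def, hG, eval_map_algebraMap]
    exact aeval_eq_zero_of_dvd_aeval_eq_zero hdv (minpoly.aeval ℚ β)
  have hFG : IsCoprime (pisotPolyReal β) G := hfg.map (mapRingHom (algebraMap ℚ ℝ))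
  rw [h.pisotPoly_eq] at hFG
  exact ⟨hc.of_mul_right_left, hc.of_mul_right_right, hFG.of_mul_left_right⟩

theorem aeval_action (h : σ.IsPrimitiveUnitPisot β) :
    aeval σ.action ((X - C β) * contractingPoly β *
      (neutralPoly σ β).map (algebraMap ℚ ℝ)) = 0 := by
  have h1 : (X - C β) * contractingPoly β * (neutralPoly σ β).map (algebraMap ℚ ℝ)
      = (σ.incidence.map (Int.castRingHom ℝ)).charpoly := by
    rw [← h.pisotPoly_eq, pisotPolyReal, ← Polynomial.map_mul, ← h.charPoly_eq,
      Substitution.charPoly, Polynomial.map_map, Matrix.charpoly_map]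
    congr 1
  have h2 : (σ.incidence.map (Int.castRingHom ℝ)).charpoly = σ.action.charpoly := by
    rw [Substitution.action, Matrix.charpoly_toLin']
    rfl
  rw [h1, h2]
  exact LinearMap.aeval_self_charpoly _

theorem isCompl_Kc (h : σ.IsPrimitiveUnitPisot β) :
    IsCompl (Kc σ β) (Ke σ β ⊔ Kn σ β) := by
  obtain ⟨h1, h2, h3⟩ := h.coprimes
  have := isCompl_aux σ.action _ _ _ h1.symm h3 h2
    (by rw [mul_comm (contractingPoly β)]; exact h.aeval_action)
  rwa [mul_comm (contractingPoly β), ← h.pisotPoly_eq] at this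

theorem isCompl_Ke (h : σ.IsPrimitiveUnitPisot β) :
    IsCompl (Ke σ β) (Kc σ β ⊔ Kn σ β) := by
  obtain ⟨h1, h2, h3⟩ := h.coprimes
  have := isCompl_aux σ.action _ _ _ h1 h2 h3 h.aeval_action
  rwa [← h.pisotPoly_eq] at this

/-- The projection onto the contracting space, for `ℝⁿ = Ke ⊕ Kc ⊕ Kn`. -/
def piC (h : σ.IsPrimitiveUnitPisot β) : (Fin n → ℝ) →ₗ[ℝ] Kc σ β :=
  Submodule.projectionOnto _ _ h.isCompl_Kc

/-- The projection onto the expanding line, for `ℝⁿ = Ke ⊕ Kc ⊕ Kn`. -/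
def piE (h : σ.IsPrimitiveUnitPisot β) : (Fin n → ℝ) →ₗ[ℝ] Ke σ β :=
  Submodule.projectionOnto _ _ h.isCompl_Ke

end Substitution.IsPrimitiveUnitPisot

/-! ### Faces -/

/-- The types `a₁ ∧ ⋯ ∧ a_k` with `a₁ < ⋯ < a_k`, encoded by the set of their letters. -/
abbrev WedgeType (n k : ℕ) : Type := {a : Finset (Fin n) // a.card = k}

/-- The letters `a₁ < ⋯ < a_k` of a type, in increasing order. -/
def WedgeType.letters (a : WedgeType n k) : Fin k → Fin n := a.1.orderEmbOfFin a.2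

/-- A `k`-dimensional face: a base point and a type. -/
abbrev Face (n k : ℕ) : Type := (Fin n → ℤ) × WedgeType n k

/-- Formal integer sums of `k`-dimensional faces. -/
abbrev Chain (n k : ℕ) : Type := Face n k →₀ ℤ

/-- Formal integer sums of duals of `k`-dimensional faces; the basis element `(x, a)` stands for
the dual face `(x, a)^*`. -/
abbrev DualChain (n k : ℕ) : Type := Face n k →₀ ℤ

/-- The face as a basis element. -/
def Face.toChain (F : Face n k) : Chain n k := Finsupp.single F 1

/-- The element `(x, w₁ ∧ ⋯ ∧ w_k)` for arbitrary letters `w₁, …, w_k`: zero if two letters agree,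
and `sgn(τ) (x, b)` if `w = b_τ` with `b₁ < ⋯ < b_k`. -/
def wedgeFace (x : Fin n → ℤ) (w : Fin k → Fin n) : Chain n k :=
  ∑ b : WedgeType n k, ∑ τ : Equiv.Perm (Fin k),
    if w = b.letters ∘ τ then Finsupp.single (x, b) ((Equiv.Perm.sign τ : ℤˣ) : ℤ) else 0

/-- The support of a face in `ℝⁿ`. -/
def Face.support (F : Face n k) : Set (Fin n → ℝ) :=
  {z | ∃ t : Fin k → ℝ, (∀ i, t i ∈ Set.Icc (0 : ℝ) 1) ∧
    z = (fun m => (F.1 m : ℝ)) + ∑ i, t i • Pi.single (F.2.letters i) (1 : ℝ)}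

/-- All coefficients of the faces appearing in the element are `1` or `-1`. -/
def IsGeometric (P : Chain n k) : Prop := ∀ F ∈ P.support, P F = 1 ∨ P F = -1

/-- A geometric element projects well onto the contracting space if the projections of its
distinct faces have disjoint interiors (in the contracting space). -/
def ProjectsWell {σ : Substitution n} {β : ℝ} (h : σ.IsPrimitiveUnitPisot β)
    (P : Chain n k) : Prop :=
  IsGeometric P ∧ ∀ F ∈ P.support, ∀ G ∈ P.support, F ≠ G →
    Disjoint (interior (h.piC '' F.support)) (interior (h.piC '' G.support))

/-! ### Extensions of substitutions and their duals -/

/-- The choices of decompositions `σ(a_i) = p_i b_i s_i`, `b_i` a letter, one for each `i`; they are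
given by the positions of the letters `b_i` in the words `σ(a_i)`. -/
abbrev Decomp (σ : Substitution n) (a : WedgeType n k) : Type :=
  ∀ i : Fin k, Fin (σ.img (a.letters i)).length

/-- The letters `b_i` of a decomposition. -/
def Decomp.mid {σ : Substitution n} {a : WedgeType n k} (c : Decomp σ a) (i : Fin k) : Fin n :=
  (σ.img (a.letters i)).get (c i)

/-- The sum of the abelianizations of the prefixes `p_i` of a decomposition. -/
def Decomp.prefixSum {σ : Substitution n} {a : WedgeType n k} (c : Decomp σ a) : Fin n → ℤ :=
  ∑ i, abel ((σ.img (a.letters i)).take (c i))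

/-- The `k`-dimensional extension `E_k(σ)`. -/
def extension (σ : Substitution n) (k : ℕ) : Chain n k →ₗ[ℤ] Chain n k :=
  Finsupp.linearCombination ℤ fun F : Face n k =>
    ∑ c : Decomp σ F.2, wedgeFace (σ.incidence.mulVec F.1 + c.prefixSum) c.mid

/-- The dual map `E_k^*(σ)`, mapping `(x, a)^*` to the sum of the
`sgn(τ) (M⁻¹ (x - l(p)), b)^*` over all `b₁ < ⋯ < b_k`, all permutations `τ` and all
decompositions `σ(b) = p a_τ s`. -/
def dualExtension (σ : Substitution n) (k : ℕ) : DualChain n k →ₗ[ℤ] DualChain n k :=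
  Finsupp.linearCombination ℤ fun F : Face n k =>
    ∑ b : WedgeType n k, ∑ c : Decomp σ b, ∑ τ : Equiv.Perm (Fin k),
      if c.mid = F.2.letters ∘ τ then
        Finsupp.single (σ.incidence⁻¹.mulVec (F.1 - c.prefixSum), b)
          ((Equiv.Perm.sign τ : ℤˣ) : ℤ)
      else 0

/-- For a unimodular substitution, `E_k^*(σ)` is indeed the dual (transpose) of `E_k(σ)`. -/
theorem dualExtension_apply (σ : Substitution n) (hσ : IsUnit σ.incidence.det)
    (F G : Face n k) :
    dualExtension σ k (Finsupp.single F 1) G = extension σ k G.toChain F := by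
  classical
  obtain ⟨x, a⟩ := F
  obtain ⟨y, b⟩ := G
  have key : ∀ p : Fin n → ℤ,
      σ.incidence⁻¹.mulVec (x - p) = y ↔ σ.incidence.mulVec y + p = x := by
    intro p
    constructor
    · rintro rfl
      rw [Matrix.mulVec_mulVec, Matrix.mul_nonsing_inv _ hσ, Matrix.one_mulVec, sub_add_cancel]
    · rintro rfl
      rw [add_sub_cancel_right, Matrix.mulVec_mulVec, Matrix.nonsing_inv_mul _ hσ,
        Matrix.one_mulVec]
  simp only [dualExtension, extension, Face.toChain, wedgeFace,
    Finsupp.linearCombination_single, one_smul, Finsupp.finsetSum_apply]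
  rw [Finset.sum_eq_single b]
  · refine Finset.sum_congr rfl fun c _ => ?_
    rw [Finset.sum_eq_single a]
    · refine Finset.sum_congr rfl fun τ _ => ?_
      by_cases hm : c.mid = a.letters ∘ τ
      · simp only [hm, if_true, Finsupp.single_apply, Prod.mk.injEq, and_true, key]
      · simp only [hm, if_false, Finsupp.coe_zero, Pi.zero_apply]
    · intro a' _ ha
      refine Finset.sum_eq_zero fun τ _ => ?_
      split_ifs
      · simp [ha]
      · rfl
    · simp
  · intro b' _ hb
    refine Finset.sum_eq_zero fun c _ => Finset.sum_eq_zero fun τ _ => ?_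
    split_ifs
    · simp [hb]
    · rfl
  · simp

/-- The exterior power `M_k^*` of the transposed incidence matrix: the matrix of its minors of
order `k`. -/
def dualMatrix (σ : Substitution n) (k : ℕ) : Matrix (WedgeType n k) (WedgeType n k) ℤ :=
  Matrix.of fun b a => (σ.incidence.transpose.submatrix b.letters a.letters).det

/-! ### The geometric realization -/

/-- The transverse type: the complementary letters in increasing order. -/
def WedgeType.compl (h : k + j = n) (a : WedgeType n k) : WedgeType n j :=
  ⟨a.1ᶜ, by rw [Finset.card_compl, Fintype.card_fin, a.2]; omega⟩

theorem WedgeType.compl_compl (h : k + j = n) (h' : j + k = n) (a : WedgeType n k) :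
    (a.compl h).compl h' = a := Subtype.ext (_root_.compl_compl a.1)

/-- `e_{a₁} + ⋯ + e_{a_k}`. -/
def WedgeType.vec (a : WedgeType n k) : Fin n → ℤ := ∑ i ∈ a.1, Pi.single i 1

/-- `(-1)^{a₁ + ⋯ + a_k}`, with the letters numbered `1, …, n`. -/
def WedgeType.sgn (a : WedgeType n k) : ℤ := (-1) ^ ∑ i ∈ a.1, ((i : ℕ) + 1)

theorem WedgeType.sgn_mul_self (a : WedgeType n k) : a.sgn * a.sgn = 1 := by
  rw [WedgeType.sgn, ← mul_pow]; simp

/-- The Poincaré map `φ_k` on duals of `k`-dimensional faces, with values in the formal sums of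
`(n - k)`-dimensional faces, `n - k = j`. -/
def poincare (h : k + j = n) : DualChain n k ≃ₗ[ℤ] Chain n j :=
  LinearEquiv.ofLinearMap
    (Finsupp.linearCombination ℤ fun F : Face n k =>
      Finsupp.single (F.1 + F.2.vec, F.2.compl h) F.2.sgn)
    (Finsupp.linearCombination ℤ fun F : Face n j =>
      Finsupp.single (F.1 - (F.2.compl (k := j) (j := k) (by omega)).vec,
        F.2.compl (k := j) (j := k) (by omega))
        (F.2.compl (k := j) (j := k) (by omega)).sgn)
    (by
      ext ⟨x, b⟩ : 2
      simp [WedgeType.compl_compl, WedgeType.sgn_mul_self])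
    (by
      ext ⟨x, a⟩ : 2
      simp [WedgeType.compl_compl, WedgeType.sgn_mul_self])

/-- The geometric dual map `E^j(σ)`, defined by `E^j(σ) ∘ φ_k = φ_k ∘ E_k^*(σ)`, `k = n - j`. -/
def geometricDual (σ : Substitution n) (h : k + j = n) : Chain n j →ₗ[ℤ] Chain n j :=
  (poincare h).toLinearMap ∘ₗ dualExtension σ k ∘ₗ (poincare h).symm.toLinearMap

/-! ### Faces near to the contracting space and nice reducible substitutions -/

/-- The half-open segment `[z₁, z₂) = {(1 - t) z₁ + t z₂ : t ∈ [0, 1)}`. -/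
def halfOpenSegment {V : Type*} [AddCommGroup V] [Module ℝ V] (z₁ z₂ : V) : Set V :=
  {z | ∃ t ∈ Set.Ico (0 : ℝ) 1, z = (1 - t) • z₁ + t • z₂}

/-- The dual faces `(x, a)^*` with `π_e(x) ∈ [-π_e(l(a)), 0)`. -/
def dualFacesNear {σ : Substitution n} {β : ℝ} (h : σ.IsPrimitiveUnitPisot β) (k : ℕ) :
    Set (Face n k) :=
  {F | h.piE (fun m => (F.1 m : ℝ)) ∈
    halfOpenSegment (-h.piE (fun m => (F.2.vec m : ℝ))) 0}

/-- The faces near to the contracting space: those appearing in the images under the Poincaré map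
of the dual faces above. -/
def facesNear {σ : Substitution n} {β : ℝ} (h : σ.IsPrimitiveUnitPisot β) (hkj : k + j = n) :
    Set (Face n j) :=
  {F | ∃ D ∈ dualFacesNear h k, F ∈ (poincare hkj (Finsupp.single D 1)).support}

/-- Nice reducible substitutions. Here `j = d - 1` and `k = n - d + 1`, where `d` is the degree of
the Pisot root `β`. -/
structure IsNiceReducible {σ : Substitution n} {β : ℝ} (h : σ.IsPrimitiveUnitPisot β)
    (hkj : k + j = n) : Prop where
  degree : (minpoly ℚ β).natDegree = j + 1
  S1 : ∀ U ∈ facesNear h hkj,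
    IsGeometric (geometricDual σ hkj U.toChain) ∧ ProjectsWell h (geometricDual σ hkj U.toChain)
  S2 : ∀ U₁ ∈ facesNear h hkj, ∀ U₂ ∈ facesNear h hkj, U₁ ≠ U₂ →
    ProjectsWell h (U₁.toChain + U₂.toChain) →
      Disjoint (geometricDual σ hkj U₁.toChain).support
          (geometricDual σ hkj U₂.toChain).support ∧
        ProjectsWell h (geometricDual σ hkj (U₁.toChain + U₂.toChain))
  P : (∀ F : Face n k, ∀ G : Face n k, 0 ≤ dualExtension σ k (Finsupp.single F 1) G) ∧
    (dualMatrix σ k).IsPrimitive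
  N : (∀ z : ℂ, aeval z (neutralPoly σ β) = 0 →
      ((neutralPoly σ β).map (algebraMap ℚ ℂ)).rootMultiplicity z = 1 ∧ ‖z‖ = 1) ∧
    (neutralPoly σ β).eval 0 = 1

/-! ### The family -/

/-- The substitution `σ_t : 1 ↦ 1^{t+1} 2, 2 ↦ 3, 3 ↦ 4, 4 ↦ 1^t 5, 5 ↦ 1`. -/
def sigmaFam (t : ℕ) : Substitution 5 where
  img := ![List.replicate (t + 1) 0 ++ [1], [2], [3], List.replicate t 0 ++ [4], [0]]
  img_ne_nil := by
    intro a
    fin_cases a <;> simp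

end PisotDual

end

namespace PisotDual

/-! ### The Pisot root -/

/-! Letters are numbered from 0. The characteristic polynomial of M is (x³ - t x² - (t+1) x - 1)(x²
- x + 1). The cubic has no root ±1, hence is irreducible; it has a root β > t + 1, and the Schur
criterion puts its other roots inside the unit disc. This gives the Pisot property and (N).

For (P), every σ(a) is a power of 0 followed by a + 1 modulo 5. Three distinct middle letters taken
from the images of three increasing letters are therefore in increasing order up to a cyclic shift,
which is even: no sign -1 occurs (`sign_eq_one_of_occurs`). As prefixes contain only the letter 0
and at most one middle letter is 0, the prefix sum determines the decomposition, so all coefficients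
of the dual map are 0 or 1 (`dualExtension_single`). Minors expand without cancellation for the same
reason, and primitivity becomes a question about paths in a fixed graph.

(S1) and (S2) are plane geometry. The forms `planeX` and `planeY` vanish on the expanding line and
the neutral space and are coordinates on the contracting plane. After applying M, the faces in the
image of a face U are products of pieces of its two edges: an edge of type 0 is kept, and any other
becomes a path made of a vertical segment up, a sloped segment and a vertical segment down, with the
same ends (`Precedes.exists_pieces`, `EdgePiece.point`). Products of two vertical pieces do not
occur. The slopes strictly decrease with the type. Hence, for two non-vertical edges, the pieces do
not overlap (`deformed_injective`, `IsPiece.unique`) and fill only the region between the two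
deformed paths around U (`deformed_bounds`); an edge of type 0 just sweeps the other deformed edge
vertically.

For (S2), non-overlapping faces U₁, U₂ are separated by a line. If their images overlapped, a
generic common point would lie strictly between a lower and an upper deformed edge of each face, and
the separating line could not be vertical. It would then suffice that the deformation preserves the
vertical order of edges (`deformed_mono`). A deformed edge never lies below the original one, so
only a lower edge of type 1 or 4, which is really raised, could break the order; it would do so only
if a vertex of the upper face lay in a small triangle above that edge. Here nearness to the
contracting plane enters: vertices of faces in S have heights in an interval of length
`totalHeight`, and no difference of lattice points with such a bounded height projects into the
triangles (`no_lattice_point_left`, `no_lattice_point_right`). -/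

/-- `β` is the dominant root of `x³ - t x² - (t + 1) x - 1`. -/
structure IsDominantRoot (t : ℕ) (β : ℝ) : Prop where
  lt : (t : ℝ) + 1 < β
  eq : β ^ 3 = t * β ^ 2 + (t + 1) * β + 1

theorem exists_isDominantRoot (t : ℕ) : ∃ β, IsDominantRoot t β := by
  have hc : ContinuousOn (fun x : ℝ => x ^ 3 - t * x ^ 2 - (t + 1) * x - 1)
      (Set.Icc ((t : ℝ) + 1) (t + 2)) := by fun_prop
  have ht : (0 : ℝ) ≤ t := t.cast_nonneg
  -- At t + 1 the cubic equals -1.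
  obtain ⟨β, hβ, h0⟩ := intermediate_value_Ioo (by linarith) hc
    (show (0 : ℝ) ∈ Set.Ioo _ _ from ⟨by nlinarith, by nlinarith⟩)
  exact ⟨β, hβ.1, by linarith [show β ^ 3 - t * β ^ 2 - (t + 1) * β - 1 = 0 from h0]⟩

namespace IsDominantRoot

variable {t : ℕ} {β : ℝ} (hβ : IsDominantRoot t β)
include hβ

theorem one_lt : 1 < β := by
  have : (0 : ℝ) ≤ t := t.cast_nonneg
  linarith [hβ.lt]

theorem pos : 0 < β := one_pos.trans hβ.one_lt

/-- The cubic equation rewritten to measure how far β exceeds t + 1. It yields both the Schur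
condition for the conjugates and the formula eliminating t in favour of β. -/
theorem gap : β * (β + 1) * (β - 1 - t) = 1 := by linarith [hβ.eq]

end IsDominantRoot

/-- The polynomial `x³ - t x² - (t + 1) x - 1`. -/
noncomputable def pisotPoly (R : Type*) [CommRing R] (t : ℕ) : R[X] :=
  X ^ 3 - (t : R[X]) * X ^ 2 - ((t : R[X]) + 1) * X - 1

theorem pisotPoly_eq_cubic (R : Type*) [CommRing R] (t : ℕ) :
    pisotPoly R t = C 1 * X ^ 3 + C (-(t : R)) * X ^ 2 + C (-(t + 1 : R)) * X + C (-1) := by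
  simp [pisotPoly]; ring

theorem pisotPoly_map {R S : Type*} [CommRing R] [CommRing S] (φ : R →+* S) (t : ℕ) :
    (pisotPoly R t).map φ = pisotPoly S t := by
  simp [pisotPoly]

theorem pisotPoly_natDegree (R : Type*) [CommRing R] [Nontrivial R] (t : ℕ) :
    (pisotPoly R t).natDegree = 3 := by
  rw [pisotPoly_eq_cubic]; exact natDegree_cubic one_ne_zero

theorem pisotPoly_monic (R : Type*) [CommRing R] [Nontrivial R] (t : ℕ) :
    (pisotPoly R t).Monic := by
  rw [Monic, pisotPoly_eq_cubic]; exact leadingCoeff_cubic one_ne_zero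

theorem pisotPoly_irreducible (t : ℕ) : Irreducible (pisotPoly ℚ t) := by
  have hm := pisotPoly_monic ℤ t
  rw [← pisotPoly_map (Int.castRingHom ℚ), ← algebraMap_int_eq ℚ,
    ← hm.irreducible_iff_irreducible_map_fraction_map,
    hm.irreducible_iff_roots_eq_zero_of_degree_le_three (by rw [pisotPoly_natDegree]; norm_num)
      (by rw [pisotPoly_natDegree])]
  refine Multiset.eq_zero_of_forall_notMem fun x hx => ?_
  have h0 : x ^ 3 - t * x ^ 2 - (t + 1) * x - 1 = 0 := by
    have := (mem_roots'.mp hx).2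
    simpa [pisotPoly, IsRoot.def] using this
  -- The constant term is -1, so an integer root divides 1.
  have hu : IsUnit x := IsUnit.of_mul_eq_one (x ^ 2 - t * x - (t + 1)) (by linear_combination h0)
  rcases Int.isUnit_iff.mp hu with rfl | rfl
  · have : (0 : ℤ) ≤ t := by positivity
    linarith
  · linarith

theorem sigmaFam_incidence (t : ℕ) : (sigmaFam t).incidence =
    !![(t : ℤ) + 1, 0, 0, t, 1; 1, 0, 0, 0, 0; 0, 1, 0, 0, 0; 0, 0, 1, 0, 0; 0, 0, 0, 1, 0] := by
  ext i j
  fin_cases i <;> fin_cases j <;>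
    simp [Substitution.incidence, sigmaFam, List.count_append, List.count_replicate]

theorem sigmaFam_charPoly (t : ℕ) :
    (sigmaFam t).charPoly = pisotPoly ℚ t * (X ^ 2 - X + 1) := by
  have : (sigmaFam t).incidence.charpoly = pisotPoly ℤ t * (X ^ 2 - X + 1) := by
    rw [sigmaFam_incidence, Matrix.charpoly]
    simp [Matrix.charmatrix, Matrix.det_succ_row_zero, Fin.sum_univ_succ, Fin.succAbove, pisotPoly,
      Matrix.diagonal]
    ring
  rw [Substitution.charPoly, this, Polynomial.map_mul, pisotPoly_map]
  simp

namespace IsDominantRoot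

variable {t : ℕ} {β : ℝ} (hβ : IsDominantRoot t β)
include hβ

theorem minpoly_eq : minpoly ℚ β = pisotPoly ℚ t := by
  refine (minpoly.eq_of_irreducible_of_monic (pisotPoly_irreducible t) ?_ (pisotPoly_monic ℚ t)).symm
  simp [pisotPoly]
  linarith [hβ.eq]

theorem isIntegral : IsIntegral ℤ β :=
  ⟨pisotPoly ℤ t, pisotPoly_monic ℤ t, by simp [pisotPoly]; linarith [hβ.eq]⟩

theorem neutralPoly_eq : neutralPoly (sigmaFam t) β = X ^ 2 - X + 1 := by
  rw [neutralPoly, hβ.minpoly_eq, sigmaFam_charPoly,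
    mul_divByMonic_cancel_left _ (pisotPoly_monic ℚ t)]

/-- Division of the cubic by z - β: the roots have sum t and product 1. -/
theorem conj_factor {z : ℂ} (h0 : z ^ 3 - t * z ^ 2 - (t + 1) * z - 1 = 0) (hz : z ≠ β) :
    z ^ 2 + (β - t : ℝ) * z + (1 / β : ℝ) = 0 := by
  have h3 : (β : ℂ) ^ 3 = t * β ^ 2 + (t + 1) * β + 1 := by exact_mod_cast hβ.eq
  have hb : (β : ℂ) ≠ 0 := by exact_mod_cast hβ.pos.ne'
  have : (z - β) * (z ^ 2 + (β - t : ℝ) * z + (1 / β : ℝ)) = 0 := by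
    push_cast
    field_simp
    linear_combination β * h0 - (z - 0) * h3
  exact (mul_eq_zero.mp this).resolve_left (sub_ne_zero.mpr hz)

end IsDominantRoot

/-- The Schur criterion for real quadratic polynomials. -/
theorem norm_lt_one_of_quadratic {s p : ℝ} (hs : 0 ≤ s) (hp : 0 < p) (hp1 : p < 1) (hsp : s < 1 + p)
    {z : ℂ} (h0 : z ^ 2 + s * z + p = 0) : ‖z‖ < 1 := by
  have hre := congrArg Complex.re h0
  have him := congrArg Complex.im h0
  simp [pow_two] at hre him
  have h2 : z.im * (2 * z.re + s) = 0 := by linarith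
  have key : z.re * z.re + z.im * z.im < 1 := by
    -- Either z is real, and the quadratic is positive on [0, ∞) and, since s < 1 + p, on (-∞, -1];
    -- or the roots have real part -s/2 and |z|² = p.
    rcases mul_eq_zero.mp h2 with h | h
    · rw [h] at hre ⊢
      have h3 : z.re < 1 := by nlinarith
      have h4 : -1 < z.re := by
        by_contra hc
        push Not at hc
        nlinarith [mul_nonneg (show 0 ≤ -z.re - 1 by linarith) (show 0 ≤ -z.re - p by linarith)]
      nlinarith
    · have : s = -2 * z.re := by linarith
      rw [this] at hre
      nlinarith
  rw [← sq_lt_one_iff₀ (norm_nonneg z), Complex.sq_norm, Complex.normSq_apply]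
  exact key

namespace IsDominantRoot

variable {t : ℕ} {β : ℝ} (hβ : IsDominantRoot t β)
include hβ

theorem norm_conj_lt_one {z : ℂ} (h0 : aeval z (pisotPoly ℚ t) = 0) (hz : z ≠ β) : ‖z‖ < 1 := by
  have hb := hβ.pos
  have h1 := hβ.one_lt
  have hl := hβ.lt
  have hq := hβ.conj_factor (by simpa [pisotPoly] using h0) hz
  have hi : 1 / β < 1 := by rw [div_lt_one hb]; exact h1
  -- Since β + 1 > 1, this gives β - t < 1 + 1/β, the remaining condition of the Schur criterion.
  have he : (β + 1) * (β - 1 - t) = 1 / β := by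
    rw [eq_div_iff hb.ne']; linarith [hβ.gap]
  exact norm_lt_one_of_quadratic (by linarith) (by positivity) hi (by nlinarith) hq

end IsDominantRoot

/-! ### The neutral polynomial, primitivity of M and the Pisot property -/

theorem norm_eq_one_of_neutral {z : ℂ} (h0 : z ^ 2 - z + 1 = 0) : ‖z‖ = 1 := by
  have h3 : z ^ 3 = -1 := by linear_combination (z + 1) * h0
  have : ‖z‖ ^ 3 = 1 := by rw [← norm_pow, h3]; simp
  exact (pow_eq_one_iff_of_nonneg (norm_nonneg z) (by norm_num)).mp this

theorem rootMultiplicity_eq_one {K : Type*} [Field K] {p : K[X]} {x : K}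
    (h0 : p.eval x = 0) (h1 : p.derivative.eval x ≠ 0) : p.rootMultiplicity x = 1 := by
  have hp : p ≠ 0 := by rintro rfl; simp at h1
  refine le_antisymm ?_ ((rootMultiplicity_pos hp).mpr h0)
  by_contra hc
  exact h1 ((one_lt_rootMultiplicity_iff_isRoot hp).mp (not_le.mp hc)).2

/-- A nonnegative matrix bounded below by the adjacency of a graph in which all pairs of vertices
are joined by paths of one and the same positive length is primitive. -/
theorem isPrimitive_of_adj {ι : Type*} [Fintype ι] [DecidableEq ι] {A : Matrix ι ι ℤ}
    (h0 : ∀ i j, 0 ≤ A i j) {m : ℕ} (e : Fin m → ι) (he : Function.Surjective e)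
    (succ : Fin m → List (Fin m)) (hs : ∀ i, ∀ j ∈ succ i, 0 < A (e i) (e j)) {k : ℕ} (hk : 0 < k)
    (hp : ∀ i j, j ∈ (fun l : List (Fin m) => (l.flatMap succ).dedup)^[k] [i]) : A.IsPrimitive := by
  refine ⟨h0, k, hk, fun a b => ?_⟩
  obtain ⟨i, rfl⟩ := he a
  obtain ⟨j, rfl⟩ := he b
  have key : ∀ k j, j ∈ (fun l : List (Fin m) => (l.flatMap succ).dedup)^[k] [i] →
      0 < (A ^ k) (e i) (e j) := by
    intro k
    induction k with
    | zero => intro j hj; simp at hj; subst hj; simp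
    | succ k ih =>
      intro j hj
      rw [Function.iterate_succ_apply', List.mem_dedup, List.mem_flatMap] at hj
      obtain ⟨c, hc, hcj⟩ := hj
      rw [pow_succ, Matrix.mul_apply]
      refine Finset.sum_pos' (fun d _ => mul_nonneg (Matrix.pow_apply_nonneg h0 _ _ _) (h0 _ _))
        ⟨e c, Finset.mem_univ _, mul_pos (ih c hc) (hs c j hcj)⟩
  exact key k j (hp i j)

theorem sigmaFam_isPrimitive (t : ℕ) : (sigmaFam t).incidence.IsPrimitive := by
  -- The entry t is left out of the graph, so that t = 0 is covered. The loop at 0 pads paths to a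
  -- common length; the longest shortest path through 0, from 4 to 1, has length 8.
  refine isPrimitive_of_adj ?_ id Function.surjective_id ![[0, 4], [0], [1], [2], [3]] ?_
    (k := 8) (by norm_num) (by decide)
  · intro i j
    exact Int.natCast_nonneg _
  · rw [sigmaFam_incidence]
    intro i
    fin_cases i <;> simp

theorem IsDominantRoot.isPrimitiveUnitPisot {t : ℕ} {β : ℝ} (hβ : IsDominantRoot t β) :
    (sigmaFam t).IsPrimitiveUnitPisot β where
  primitive := sigmaFam_isPrimitive t
  isIntegral := hβ.isIntegral
  one_lt := hβ.one_lt
  conj_lt_one z h0 hz := hβ.norm_conj_lt_one (by rwa [hβ.minpoly_eq] at h0) hz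
  norm_unit := by rw [hβ.minpoly_eq, coeff_zero_eq_eval_zero]; simp [pisotPoly]
  eigenvalue_simple := by
    have h1 := hβ.one_lt
    have ht : (0 : ℝ) ≤ t := t.cast_nonneg
    have h3 := hβ.eq
    have hl := hβ.lt
    apply rootMultiplicity_eq_one
    · rw [sigmaFam_charPoly]
      simp [pisotPoly]
      left; linarith
    · rw [sigmaFam_charPoly]
      simp [pisotPoly, derivative_pow]
      rw [show β ^ 3 - t * β ^ 2 - (t + 1) * β - 1 = 0 by linarith, zero_mul, add_zero]
      have h4 : 0 < 3 * β ^ 2 - t * (2 * β) - (t + 1) := by nlinarith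
      have h5 : 0 < β ^ 2 - β + 1 := by nlinarith
      exact (mul_pos h4 h5).ne'
  dominant z h0 hz := by
    rw [sigmaFam_charPoly, map_mul, mul_eq_zero] at h0
    rcases h0 with h0 | h0
    · exact (hβ.norm_conj_lt_one h0 hz).trans hβ.one_lt
    · rw [norm_eq_one_of_neutral (by simpa using h0)]
      exact hβ.one_lt

theorem IsDominantRoot.isReducible {t : ℕ} {β : ℝ} (hβ : IsDominantRoot t β) :
    IsReducible (sigmaFam t) β := by
  rw [IsReducible, hβ.neutralPoly_eq]
  intro h
  have := congrArg (eval (2 : ℚ)) h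
  norm_num at this

theorem IsDominantRoot.neutral_condition {t : ℕ} {β : ℝ} (hβ : IsDominantRoot t β) :
    (∀ z : ℂ, aeval z (neutralPoly (sigmaFam t) β) = 0 →
      ((neutralPoly (sigmaFam t) β).map (algebraMap ℚ ℂ)).rootMultiplicity z = 1 ∧ ‖z‖ = 1) ∧
    (neutralPoly (sigmaFam t) β).eval 0 = 1 := by
  rw [hβ.neutralPoly_eq]
  refine ⟨fun z hz => ?_, by simp⟩
  have h0 : z ^ 2 - z + 1 = 0 := by simpa using hz
  refine ⟨rootMultiplicity_eq_one (by simpa using h0) ?_, norm_eq_one_of_neutral h0⟩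
  simp
  intro h1
  -- The discriminant of x² - x + 1 is -3, so there is no double root.
  have : (3 : ℂ) = 0 := by linear_combination 4 * h0 - (2 * z - 1) * h1
  norm_num at this

/-! ### Edges in the plane and their deformations

The contracting plane is given coordinates `(q, r)` such that the edges of type `1` are the vertical
unit segments. An edge of type `i ≠ 0` (the letters being numbered from `0`) is the segment from its
left end `(x, y)` to `(x + width i, y + rise i)`. The substitution replaces it, up to the linear
map `M`, by a vertical segment of length `lift i` at the left end, a segment of slope `slope i`, and
a vertical segment of length `drop i` downwards at the right end. -/

/-- The length of the projection of an edge to the horizontal axis. -/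
noncomputable def width (β : ℝ) : Fin 5 → ℝ := ![0, 1 / β, 1 + 1 / β, 1 + 1 / β, 1]

/-- The difference of the heights of the ends of an edge. -/
noncomputable def rise (β : ℝ) : Fin 5 → ℝ := ![1, β + 1, β + 1, β, 0]

/-- The slope of the deformed edge. -/
noncomputable def slope (t : ℕ) (β : ℝ) : Fin 5 → ℝ :=
  ![0, β + 1 / (β + 1), β, β - 1 + 1 / (β + 1), t]

/-- The length of the vertical segment of the deformed edge at its left end. -/
noncomputable def lift (t : ℕ) : Fin 5 → ℝ := ![0, t + 1, 0, 0, 0]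

/-- The length of the vertical segment of the deformed edge at its right end. -/
noncomputable def drop (t : ℕ) : Fin 5 → ℝ := ![0, 0, 0, 0, t]

/-- Together with `drop_nonneg`, this says that the sloped part of a deformed edge starts and ends
on or above the original edge, hence never lies below it. -/
theorem lift_nonneg (t : ℕ) (i : Fin 5) : 0 ≤ lift t i := by
  fin_cases i <;> simp [lift]; positivity

theorem drop_nonneg (t : ℕ) (i : Fin 5) : 0 ≤ drop t i := by
  fin_cases i <;> simp [drop]

section

variable {t : ℕ} {β : ℝ} (hβ : IsDominantRoot t β)
include hβ

/-- Substituting this for t turns the identities between widths, rises and slopes into rational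
identities in β alone. -/
theorem IsDominantRoot.cast_eq : (t : ℝ) = β - 1 - 1 / (β * (β + 1)) := by
  have := hβ.pos
  have h := hβ.gap
  rw [eq_comm, ← sub_eq_zero]
  field_simp
  linarith

theorem width_pos {i : Fin 5} (hi : i ≠ 0) : 0 < width β i := by
  have := hβ.pos
  fin_cases i <;> simp_all [width] <;> positivity

/-- With u = 1/(β+1) and v = 1/(β(β+1)) the slopes for types 1 to 4 are β + u, β, β - 1 + u and β -
1 - v, where 0 < u < 1. This order decides which of the two deformed paths around a face is the
upper one. -/
theorem slope_lt {i j : Fin 5} (hi : i ≠ 0) (hij : i < j) : slope t β j < slope t β i := by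
  have := hβ.pos
  have h1 : 0 < 1 / (β + 1) := by positivity
  have h2 : 1 / (β + 1) < 1 := by rw [div_lt_one (by positivity)]; linarith
  have h3 : 0 < 1 / (β * (β + 1)) := by positivity
  have h4 := hβ.cast_eq
  simp only [slope]
  generalize 1 / (β + 1) = u at *
  generalize 1 / (β * (β + 1)) = v at *
  fin_cases i <;> fin_cases j <;> simp at hi hij ⊢ <;> linarith

theorem slope_le {i j : Fin 5} (hi : i ≠ 0) (hij : i ≤ j) : slope t β j ≤ slope t β i := by
  rcases hij.eq_or_lt with rfl | h
  · exact le_rfl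
  · exact (slope_lt hβ hi h).le

/-- The deformed path has the same ends as the edge, so the deformed paths around a face close up.
-/
theorem rise_eq {i : Fin 5} (hi : i ≠ 0) :
    rise β i = lift t i + slope t β i * width β i - drop t i := by
  have := hβ.pos
  have h := hβ.cast_eq
  fin_cases i <;> simp [rise, lift, slope, width, drop] at hi ⊢ <;> simp at h <;>
    try rw [h]
  all_goals field_simp <;> ring

end

/-- Interiors of the segments of a deformed edge, relative to the left end. -/
def OnDeformed (w σ c e q r : ℝ) : Prop :=
  (∃ s, 0 < s ∧ s < w ∧ q = s ∧ r = c + σ * s) ∨ (q = 0 ∧ 0 < r ∧ r < c) ∨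
    (q = w ∧ c + σ * w - e < r ∧ r < c + σ * w)

section

variable {w σ c e w' σ' c' e' q r q' r' : ℝ} (hσ : σ' < σ) (hw : 0 < w) (hw' : 0 < w')
  (he : e = 0) (hc' : c' = 0)
  (h : OnDeformed w σ c e q r) (h' : OnDeformed w' σ' c' e' q' r')
  (hne : 0 < q ∧ q < w ∨ 0 < q' ∧ q' < w')
include hσ hw hw' he hc' h h' hne

/-- A sum of points of two deformed edges lies between the two deformed paths from the left to the
right end of the face. -/
theorem deformed_bounds (hc : 0 ≤ c) (he' : 0 ≤ e') (h1 : q + q' ≠ w) (h2 : q + q' ≠ w') :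
    (q + q' < w' ∧ c' + σ' * (q + q') < r + r' ∨ w' < q + q' ∧
      c' + σ' * w' - e' + (c + σ * (q + q' - w')) < r + r') ∧
    (q + q' < w ∧ r + r' < c + σ * (q + q') ∨ w < q + q' ∧
      r + r' < c + σ * w - e + (c' + σ' * (q + q' - w))) ∧ 0 < q + q' ∧ q + q' < w + w' := by
  -- The path along the steeper edge first is the upper one. In each pair of segments the gap to
  -- either path is a sum of vertical lengths and of products of the slope difference with
  -- horizontal distances.
  subst he hc'
  rcases h with ⟨s, hs, hs', rfl, rfl⟩ | ⟨rfl, hr, hrc⟩ | ⟨rfl, hr, hrc⟩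
  · rcases h' with ⟨s', hs1, hs1', rfl, rfl⟩ | ⟨rfl, hr', hrc'⟩ | ⟨rfl, hr', hrc'⟩
    · have := mul_pos (sub_pos.mpr hσ) hs
      have := mul_pos (sub_pos.mpr hσ) hs1
      have := mul_pos (sub_pos.mpr hσ) (sub_pos.mpr hs')
      have := mul_pos (sub_pos.mpr hσ) (sub_pos.mpr hs1')
      refine ⟨?_, ?_, by linarith, by linarith⟩
      · rcases lt_or_gt_of_ne h2 with h2 | h2
        · left; constructor <;> linarith
        · right; constructor <;> linarith
      · rcases lt_or_gt_of_ne h1 with h1 | h1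
        · left; constructor <;> linarith
        · right; constructor <;> linarith
    · linarith
    · have := mul_pos (sub_pos.mpr hσ) (sub_pos.mpr hs')
      have := mul_pos (sub_pos.mpr hσ) hw'
      refine ⟨Or.inr ⟨by linarith, by linarith⟩, ?_, by linarith, by linarith⟩
      rcases lt_or_gt_of_ne h1 with h1 | h1
      · left; constructor <;> linarith
      · right; constructor <;> linarith
  · rcases h' with ⟨s', hs1, hs1', rfl, rfl⟩ | ⟨rfl, hr', hrc'⟩ | ⟨rfl, hr', hrc'⟩
    · have := mul_pos (sub_pos.mpr hσ) hw
      have := mul_pos (sub_pos.mpr hσ) hs1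
      refine ⟨Or.inl ⟨by linarith, by linarith⟩, ?_, by linarith, by linarith⟩
      rcases lt_or_gt_of_ne h1 with h1 | h1
      · left; constructor <;> linarith
      · right; constructor <;> linarith
    · linarith
    · rcases hne with h | h <;> linarith
  · linarith

/-- The point of a sum of two deformed edges determines the segments of the deformed edges. -/
theorem deformed_injective {q₁ r₁ q₁' r₁' : ℝ} (h₁ : OnDeformed w σ c e q₁ r₁)
    (h₁' : OnDeformed w' σ' c' e' q₁' r₁') (hne₁ : 0 < q₁ ∧ q₁ < w ∨ 0 < q₁' ∧ q₁' < w')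
    (hq : q + q' = q₁ + q₁') (hr : r + r' = r₁ + r₁') :
    (q = 0 ↔ q₁ = 0) ∧ (q' = w' ↔ q₁' = w') ∧ (q = 0 → r = r₁) ∧ (q' = w' → r' = r₁') := by
  -- Only one direction of each equivalence is needed: exchanging the two points gives the other.
  have key : ∀ {q r q' r' q₁ r₁ q₁' r₁' : ℝ}, OnDeformed w σ c e q r →
      OnDeformed w' σ' c' e' q' r' → OnDeformed w σ c e q₁ r₁ → OnDeformed w' σ' c' e' q₁' r₁' →
      (0 < q ∧ q < w ∨ 0 < q' ∧ q' < w') → (0 < q₁ ∧ q₁ < w ∨ 0 < q₁' ∧ q₁' < w') →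
      q + q' = q₁ + q₁' → r + r' = r₁ + r₁' →
      (q = 0 → q₁ = 0 ∧ r = r₁) ∧ (q' = w' → q₁' = w' ∧ r' = r₁') := by
    intro q r q' r' q₁ r₁ q₁' r₁' h h' h₁ h₁' hne hne₁ hq hr
    subst he hc'
    constructor
    · rintro rfl
      have hr0 : r < c := by
        rcases h with ⟨s, hs, hs', rfl, rfl⟩ | ⟨_, _, hrc⟩ | ⟨rfl, _, _⟩ <;> linarith
      obtain ⟨s', hs1, hs1', rfl, rfl⟩ : ∃ s, 0 < s ∧ s < w' ∧ q' = s ∧ r' = 0 + σ' * s := by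
        rcases h' with h' | ⟨rfl, _, _⟩ | ⟨rfl, _, _⟩
        · exact h'
        · rcases hne with h | h <;> linarith
        · rcases hne with h | h <;> linarith
      rcases h₁ with ⟨s, hs, hs', rfl, rfl⟩ | ⟨rfl, hr₁, hrc⟩ | ⟨rfl, hr₁, hrc⟩
      · have := mul_pos (sub_pos.mpr hσ) hs
        rcases h₁' with ⟨s', hs1, hs1', rfl, rfl⟩ | ⟨rfl, hr', hrc'⟩ | ⟨rfl, hr', hrc'⟩
        -- If the second point were on the sloped part of the steeper edge, the difference of slopes
        -- would force r > c, outside the initial vertical segment.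
        · have : r = c + (σ - σ') * q₁ := by linear_combination hr - σ' * hq
          linarith
        · linarith
        · linarith
      · have hq' : q' = q₁' := by linarith
        rcases h₁' with ⟨s', hs1, hs1', rfl, rfl⟩ | ⟨rfl, hr', hrc'⟩ | ⟨rfl, hr', hrc'⟩
        · subst hq'
          exact ⟨rfl, by linarith⟩
        · linarith
        · linarith
      · linarith
    · rintro rfl
      have hr0 : 0 + σ' * q' - e' < r' ∧ r' < 0 + σ' * q' := by
        rcases h' with ⟨s, hs, hs', rfl, rfl⟩ | ⟨_, _, hrc⟩ | ⟨_, h3, h4⟩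
        · linarith
        · linarith
        · exact ⟨h3, h4⟩
      obtain ⟨s', hs1, hs1', rfl, rfl⟩ : ∃ s, 0 < s ∧ s < w ∧ q = s ∧ r = c + σ * s := by
        rcases h with h | ⟨rfl, _, _⟩ | ⟨rfl, _, _⟩
        · exact h
        · rcases hne with h | h <;> linarith
        · linarith
      rcases h₁' with ⟨s', hs, hs', rfl, rfl⟩ | ⟨rfl, hr₁, hrc⟩ | ⟨rfl, hr₁, hrc⟩
      · have := mul_pos (sub_pos.mpr hσ) (sub_pos.mpr hs')
        rcases h₁ with ⟨s, hs1, hs1', rfl, rfl⟩ | ⟨rfl, hr', hrc'⟩ | ⟨rfl, hr', hrc'⟩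
        · have : r' = σ' * q' + (σ - σ') * (q' - q₁') := by linear_combination hr - σ * hq
          linarith
        · linarith
        · linarith
      · linarith
      · have hq' : q = q₁ := by linarith
        rcases h₁ with ⟨s, hs1, hs1', rfl, rfl⟩ | ⟨rfl, hr', hrc'⟩ | ⟨rfl, hr', hrc'⟩
        · subst hq'
          exact ⟨rfl, by linarith⟩
        · linarith
        · linarith
  have k1 := key h h' h₁ h₁' hne hne₁ hq hr
  have k2 := key h₁ h₁' h h' hne₁ hne hq.symm hr.symm
  exact ⟨⟨fun h => (k1.1 h).1, fun h => (k2.1 h).1⟩, ⟨fun h => (k1.2 h).1, fun h => (k2.2 h).1⟩,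
    fun h => (k1.1 h).2, fun h => (k1.2 h).2⟩

end

/-- A deformed edge is above another one if the edges themselves are separated by a line, provided
that two configurations of their ends are excluded. -/
theorem deformed_le_deformed {t : ℕ} {β : ℝ} (hβ : IsDominantRoot t β) {i j : Fin 5} (hi : i ≠ 0)
    (hj : j ≠ 0) {x y x' y' m n q : ℝ}
    (h1 : m * x + n ≤ y) (h2 : m * (x + width β i) + n ≤ y + rise β i)
    (h3 : y' ≤ m * x' + n) (h4 : y' + rise β j ≤ m * (x' + width β j) + n)
    (hq1 : x < q) (hq2 : q < x + width β i) (hq3 : x' < q) (hq4 : q < x' + width β j)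
    (hleft : j = 4 → x' < x → x < x' + 1 → y' ≤ y → y < y' + t * (x - x') → False)
    (hright : j = 1 → ∀ u, u = x' + width β j - (x + width β i) → 0 < u → u < 1 / β →
      y' + rise β j - β * (β + 1) * u ≤ y + rise β i →
      y + rise β i < y' + rise β j - slope t β 1 * u → False) :
    y' + lift t j + slope t β j * (q - x') ≤ y + lift t i + slope t β i * (q - x) := by
  have hw := width_pos hβ hi
  have hw' := width_pos hβ hj
  have hr := rise_eq hβ hi
  have hr' := rise_eq hβ hj
  have hc := lift_nonneg t i
  have he := drop_nonneg t i
  -- The upper deformed edge stays above the separating line, because lift and drop only raise it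
  -- over the original edge.
  have line_le : ∀ z, x ≤ z → z ≤ x + width β i →
      m * z + n ≤ y + lift t i + slope t β i * (z - x) := by
    intro z hz1 hz2
    have e1 := mul_nonneg (sub_nonneg.mpr hz1)
      (show 0 ≤ y + rise β i + drop t i - (m * (x + width β i) + n) by linarith)
    have e2 := mul_nonneg (sub_nonneg.mpr hz2)
      (show 0 ≤ y + lift t i - (m * x + n) by linarith)
    rw [hr] at e1
    refine le_of_mul_le_mul_left ?_ hw
    linarith
  have le_line : ∀ z, x' ≤ z → z ≤ x' + width β j →
      width β j * y' + rise β j * (z - x') ≤ width β j * (m * z + n) := by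
    intro z hz1 hz2
    have e1 := mul_nonneg (sub_nonneg.mpr hz1) (sub_nonneg.mpr h4)
    have e2 := mul_nonneg (sub_nonneg.mpr hz2) (sub_nonneg.mpr h3)
    linarith
  -- Without lift and drop the lower edge is not deformed at all, and the line itself separates.
  have straight : lift t j = 0 → drop t j = 0 →
      y' + lift t j + slope t β j * (q - x') ≤ y + lift t i + slope t β i * (q - x) := by
    intro ha hb
    refine le_trans ?_ (line_le q hq1.le hq2.le)
    have := le_line q hq3.le hq4.le
    rw [hr', ha, hb] at this
    rw [ha]
    refine le_of_mul_le_mul_left ?_ hw'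
    linarith
  fin_cases j
  · exact absurd rfl hj
  · clear straight
    have hb := hβ.pos
    have hs : slope t β i ≤ slope t β 1 := by
      exact slope_le hβ (by decide) ((by decide : ∀ i : Fin 5, i ≠ 0 → 1 ≤ i) i hi)
    have hd : drop t 1 = 0 := rfl
    have hwj : width β 1 = 1 / β := rfl
    have hrj : rise β 1 = β * (β + 1) * (1 / β) := by simp [rise]; field_simp
    simp only [Fin.mk_one] at *
    have hz : 0 < x' + width β 1 - q := by linarith
    suffices h : y' + rise β 1 - slope t β 1 * (x' + width β 1 - q) ≤
        y + lift t i + slope t β i * (q - x) by rw [hr', hd] at h; linarith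
    -- A deformed edge of type 1 is a segment of maximal slope ending at the right end of the edge.
    -- Going left from the first of the two right ends, the edge of type i descends no faster; so it
    -- is enough to compare there. If that is the end of the upper edge, `hright` keeps it out of
    -- the triangle between the edge of type 1 and its deformation.
    rcases lt_or_ge (x + width β i) (x' + width β 1) with hx | hx
    · have h5 := le_line (x + width β i) (by linarith) hx.le
      have h6 : y' + rise β 1 - β * (β + 1) * (x' + width β 1 - (x + width β i)) ≤
          y + rise β i := by
        refine le_of_mul_le_mul_left ?_ hw'
        have := mul_le_mul_of_nonneg_left h2 hw'.le
        rw [hrj, hwj] at h5 ⊢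
        rw [hwj] at this
        have h7 : 1 / β * β = 1 := by field_simp
        linarith
      have h7 := not_lt.mp
        (hright trivial _ rfl (by linarith) (by rw [← hwj]; linarith) h6)
      have := mul_le_mul_of_nonneg_right hs (show 0 ≤ x + width β i - q by linarith)
      linarith
    · have h5 := le_line (x' + width β 1) (by linarith) le_rfl
      have h6 := line_le (x' + width β 1) (by linarith) hx
      have := mul_le_mul_of_nonneg_right hs hz.le
      linarith
  · exact straight rfl rfl
  · exact straight rfl rfl
  · clear straight
    have hs : slope t β 4 ≤ slope t β i := slope_le hβ hi ((by decide : ∀ i : Fin 5, i ≤ 4) i)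
    have hwj : width β 4 = 1 := rfl
    have hrj : rise β 4 = 0 := rfl
    have hlj : lift t 4 = 0 := rfl
    have hsj : slope t β 4 = t := rfl
    simp only [Fin.reduceFinMk] at *
    rw [hwj] at hq4
    rw [hrj, hwj] at le_line
    rw [hlj, hsj, add_zero]
    rw [hsj] at hs
    -- The mirror image of the previous case: an edge of type 4 is deformed to a segment of minimal
    -- slope t from its left end, so the comparison is made at the last of the two left ends, and
    -- `hleft` excludes the triangle.
    rcases lt_or_ge x' x with hx | hx
    · have h5 := le_line x hx.le (by linarith)
      have h7 := not_lt.mp (hleft trivial hx (by linarith) (by linarith))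
      have := mul_le_mul_of_nonneg_right hs (show 0 ≤ q - x by linarith)
      linarith
    · have h5 := le_line x' le_rfl (by linarith)
      have h6 := line_le x' hx (by linarith)
      have := mul_le_mul_of_nonneg_right hs (show 0 ≤ q - x' by linarith)
      linarith

/-! ### Heights of lattice points -/

/-- The sum of the heights of the unit vectors. -/
noncomputable def totalHeight (β : ℝ) : ℝ := 2 * β + 1 + 1 / (β + 1)

/-- The height is split into a combination of the two plane coordinates and a multiple of b. The
factor of b is at least `totalHeight`, so points near the origin of the plane with bounded height
have very few possible values of b. -/
theorem height_decomposition {β : ℝ} (hb : 1 < β) (a b c : ℤ) :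
    β * a + b / (β + 1) + c = β * (a - (β + 1) * b) + (c - b / β) +
      b * (β * (β + 1) + 1 / β + 1 / (β + 1)) := by
  have : 0 < β := by linarith
  field_simp
  ring

theorem totalHeight_le {β : ℝ} (hb : 1 < β) :
    totalHeight β ≤ β * (β + 1) + 1 / β + 1 / (β + 1) := by
  have h0 : 0 < β := by linarith
  have h1 : 1 / β < 1 := by rw [div_lt_one h0]; exact hb
  have h2 : 1 / β * β = 1 := by field_simp
  -- Expanded, this product is the difference of the two sides.
  have : 0 < (β - 1) * (β - 1 / β) := mul_pos (by linarith) (by linarith)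
  rw [totalHeight]
  nlinarith

/-- For b > 0 the height is too large. For b = 0 the horizontal coordinate would be an integer
strictly between 0 and 1. For b = -1 one gets a < -2 and c ≤ 0, and the height is below the lower
bound, which is attuned to this case; smaller b are worse. -/
theorem no_lattice_point_left {t : ℕ} {β : ℝ} (hβ : IsDominantRoot t β) {a b c : ℤ}
    (h1 : 0 < c - b / β) (h2 : c - b / β < 1) (h3 : 0 ≤ a - (β + 1) * b)
    (h4 : a - (β + 1) * b < t * (c - b / β))
    (h5 : -(2 * β + 1 / (β + 1)) < β * a + b / (β + 1) + c)
    (h6 : β * a + b / (β + 1) + c < totalHeight β) : False := by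
  have hb := hβ.one_lt
  have h0 := hβ.pos
  have hW := totalHeight_le hb
  have hd := height_decomposition hb a b c
  have ht : (0 : ℝ) ≤ t := t.cast_nonneg
  have hW0 : 0 < β * (β + 1) + 1 / β + 1 / (β + 1) := by positivity
  rcases lt_trichotomy b 0 with hb0 | rfl | hb0
  · have hlt : a - (β + 1) * b < t := by nlinarith
    have htl : (t : ℝ) < β - 1 := by linarith [hβ.lt]
    rcases eq_or_ne b (-1) with rfl | hb1
    · have hc : c ≤ 0 := by
        have : (0 : ℝ) < 1 / β := by positivity
        have h7 : (c : ℝ) < 1 := by push_cast at h2; linarith [neg_div β (1 : ℝ)]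
        exact Int.lt_add_one_iff.mp (by exact_mod_cast h7)
      have hc' : (c : ℝ) ≤ 0 := by exact_mod_cast hc
      push_cast at *
      rw [neg_div] at h5
      nlinarith
    · have hb2 : (b : ℝ) ≤ -2 := by exact_mod_cast (by omega : b ≤ -2)
      have h7 : (b : ℝ) * (β * (β + 1) + 1 / β + 1 / (β + 1)) ≤
          -2 * (β * (β + 1) + 1 / β + 1 / (β + 1)) := by nlinarith
      have h8 : β * (a - (β + 1) * b) < β * (β - 1) := by nlinarith
      have : 0 < 1 / β := by positivity
      have : 0 < 1 / (β + 1) := by positivity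
      nlinarith
  · simp at h1 h2
    have : (0 : ℤ) < c := by exact_mod_cast h1
    have : c < (1 : ℤ) := by exact_mod_cast h2
    omega
  · have hb1 : (1 : ℝ) ≤ b := by exact_mod_cast hb0
    have := mul_nonneg h0.le h3
    nlinarith

/-- Both plane coordinates are negative, so b < 0 makes the height too small. For b = 0 and b = 1
the integer c would lie strictly between consecutive integers. For b ≥ 2 the coordinates can cancel
less than one multiple of the factor in `height_decomposition`, and the height is too large. -/
theorem no_lattice_point_right {t : ℕ} {β : ℝ} (hβ : IsDominantRoot t β) {a b c : ℤ} {u : ℝ}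
    (hu : u = -(c - b / β)) (h1 : 0 < u) (h2 : u < 1 / β)
    (h3 : -(β * (β + 1) * u) ≤ a - (β + 1) * b) (h4 : a - (β + 1) * b < -(slope t β 1 * u))
    (h5 : -totalHeight β < β * a + b / (β + 1) + c)
    (h6 : β * a + b / (β + 1) + c < totalHeight β) : False := by
  have hb := hβ.one_lt
  have h0 := hβ.pos
  have hW := totalHeight_le hb
  have hd := height_decomposition hb a b c
  have hi : 1 / β < 1 := by rw [div_lt_one h0]; exact hb
  have hi0 : 0 < 1 / β := by positivity
  have hj0 : 0 < 1 / (β + 1) := by positivity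
  have hi1 : 1 / β * β = 1 := by field_simp
  have hσ : 0 < slope t β 1 := by simp only [slope]; simp; positivity
  rcases le_or_gt b 1 with hb0 | hb0
  · rcases lt_or_ge b 0 with hb1 | hb1
    · have hb2 : (b : ℝ) ≤ -1 := by exact_mod_cast (by omega : b ≤ -1)
      have := mul_pos hσ h1
      nlinarith
    · have hb2 : (b : ℝ) / β = b * (1 / β) := by ring
      have : b = 0 ∨ b = 1 := by omega
      have h7 : (-1 : ℝ) < c ∧ (c : ℝ) < 0 ∨ (0 : ℝ) < c ∧ (c : ℝ) < 1 := by
        rcases this with rfl | rfl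
        · left; push_cast at hb2; constructor <;> linarith
        · right; push_cast at hb2; constructor <;> linarith
      rcases h7 with ⟨h7, h8⟩ | ⟨h7, h8⟩
      · have : -1 < c := by exact_mod_cast h7
        have : c < 0 := by exact_mod_cast h8
        omega
      · have : 0 < c := by exact_mod_cast h7
        have : c < 1 := by exact_mod_cast h8
        omega
  · have hb2 : (2 : ℝ) ≤ b := by exact_mod_cast hb0
    have h7 : 2 * (β * (β + 1) + 1 / β + 1 / (β + 1)) ≤
        b * (β * (β + 1) + 1 / β + 1 / (β + 1)) := by
      exact mul_le_mul_of_nonneg_right hb2 (by positivity)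
    have h8 : -(β * (β + 1)) ≤ β * (a - (β + 1) * b) := by
      have h9 : u * β < 1 := by
        have := mul_lt_mul_of_pos_right h2 h0
        linarith
      have := mul_le_mul_of_nonneg_left h3 h0.le
      have : 0 < β * (β + 1) := by positivity
      nlinarith
    linarith

/-! ### Coordinates of the contracting plane -/

/-- The horizontal coordinate of the projection to the contracting plane. -/
noncomputable def planeX (β : ℝ) : (Fin 5 → ℝ) →ₗ[ℝ] ℝ :=
  Fintype.linearCombination ℝ ![0, -(1 / β), 1 + 1 / β, -(1 + 1 / β), 1]

/-- The vertical coordinate of the projection to the contracting plane. -/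
noncomputable def planeY (β : ℝ) : (Fin 5 → ℝ) →ₗ[ℝ] ℝ :=
  Fintype.linearCombination ℝ ![1, -(β + 1), β + 1, -β, 0]

/-- The left eigenvector of the incidence matrix for the eigenvalue `β`. -/
noncomputable def height (β : ℝ) : (Fin 5 → ℝ) →ₗ[ℝ] ℝ :=
  Fintype.linearCombination ℝ ![β, 1 / (β + 1), β / (β + 1), β ^ 2 / (β + 1), 1]

theorem planeX_apply (β : ℝ) (x : Fin 5 → ℝ) :
    planeX β x = -(1 / β) * x 1 + (1 + 1 / β) * x 2 - (1 + 1 / β) * x 3 + x 4 := by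
  simp [planeX, Fintype.linearCombination_apply, Fin.sum_univ_five]; ring

theorem planeY_apply (β : ℝ) (x : Fin 5 → ℝ) :
    planeY β x = x 0 - (β + 1) * x 1 + (β + 1) * x 2 - β * x 3 := by
  simp [planeY, Fintype.linearCombination_apply, Fin.sum_univ_five]; ring

theorem height_apply (β : ℝ) (x : Fin 5 → ℝ) : height β x =
    β * x 0 + 1 / (β + 1) * x 1 + β / (β + 1) * x 2 + β ^ 2 / (β + 1) * x 3 + x 4 := by
  simp [height, Fintype.linearCombination_apply, Fin.sum_univ_five]; ring

theorem action_apply (t : ℕ) (x : Fin 5 → ℝ) :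
    (sigmaFam t).action x = ![(t + 1) * x 0 + t * x 3 + x 4, x 0, x 1, x 2, x 3] := by
  rw [Substitution.action, sigmaFam_incidence, Matrix.toLin'_apply]
  ext i
  fin_cases i <;> simp [Matrix.mulVec, dotProduct, Fin.sum_univ_five]

theorem action_eq_of_mem_Ke {t : ℕ} {β : ℝ} {x : Fin 5 → ℝ} (hx : x ∈ Ke (sigmaFam t) β) :
    (sigmaFam t).action x = β • x := by
  rw [Ke, LinearMap.mem_ker] at hx
  simpa [sub_eq_zero] using hx

/-! ### The plane coordinates and the height on the three invariant subspaces -/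

namespace IsDominantRoot

variable {t : ℕ} {β : ℝ} (hβ : IsDominantRoot t β)
include hβ

theorem planeX_action (x : Fin 5 → ℝ) :
    planeX β ((sigmaFam t).action x) = -(1 / β) * planeY β x := by
  have := hβ.pos
  rw [planeX_apply, planeY_apply, action_apply]
  simp
  field_simp
  ring

theorem planeY_action (x : Fin 5 → ℝ) :
    planeY β ((sigmaFam t).action x) = planeX β x - (β - t) * planeY β x := by
  have := hβ.pos
  rw [planeX_apply, planeY_apply, planeY_apply, action_apply]
  simp
  field_simp
  linear_combination (x 2 - x 1 - x 3) * hβ.eq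

theorem height_action (x : Fin 5 → ℝ) :
    height β ((sigmaFam t).action x) = β * height β x := by
  have := hβ.pos
  rw [height_apply, height_apply, action_apply]
  simp
  field_simp
  linear_combination - (x 0 + x 3) * hβ.eq

theorem contractingPoly_eq : contractingPoly β = X ^ 2 + C (β - t) * X + C (1 / β) := by
  have hb := hβ.pos.ne'
  have : pisotPolyReal β = (X - C β) * (X ^ 2 + C (β - t) * X + C (1 / β)) := by
    rw [pisotPolyReal, hβ.minpoly_eq, pisotPoly_map, pisotPoly]
    have h1 : (C β : ℝ[X]) * C (1 / β) = 1 := by rw [← C_mul, mul_one_div_cancel hb, C_1]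
    have h2 : C (1 / β : ℝ) = C β ^ 2 - (t : ℝ[X]) * C β - ((t : ℝ[X]) + 1) := by
      have : 1 / β = β ^ 2 - t * β - (t + 1) := by
        rw [div_eq_iff hb]; linarith [hβ.eq]
      rw [this]; simp
    rw [C_sub, C_eq_natCast]
    linear_combination h1 - X * h2
  rw [contractingPoly, this, mul_divByMonic_cancel_left _ (monic_X_sub_C β)]

theorem aeval_contractingPoly (x : Fin 5 → ℝ) :
    aeval (sigmaFam t).action (contractingPoly β) x =
      (sigmaFam t).action ((sigmaFam t).action x) + (β - t) • (sigmaFam t).action x +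
        (1 / β) • x := by
  rw [hβ.contractingPoly_eq]
  simp only [map_add, map_mul, aeval_X, aeval_C, pow_two, LinearMap.add_apply,
    Module.End.mul_apply, Module.algebraMap_end_apply]

/-- On an eigenvector for β the two coordinates would satisfy the 2 × 2 system of M with eigenvalue
β, whose characteristic polynomial x² + (β - t)x + 1/β has no positive root. -/
theorem plane_eq_zero_of_mem_Ke {x : Fin 5 → ℝ} (hx : x ∈ Ke (sigmaFam t) β) :
    planeX β x = 0 ∧ planeY β x = 0 := by
  have h1 := hβ.planeX_action x
  have h2 := hβ.planeY_action x
  have hb := hβ.pos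
  have hl := hβ.lt
  rw [action_eq_of_mem_Ke hx, map_smul, smul_eq_mul] at h1 h2
  have h3 : planeX β x = -(1 / β ^ 2) * planeY β x := by
    field_simp at h1 ⊢
    linarith
  rw [h3] at h2
  have h4 : (β + 1 / β ^ 2 + (β - t)) * planeY β x = 0 := by linarith
  have h5 : 0 < β + 1 / β ^ 2 + (β - t) := by
    have : 0 < 1 / β ^ 2 := by positivity
    linarith
  have h6 := (mul_eq_zero.mp h4).resolve_left h5.ne'
  exact ⟨by rw [h3, h6, mul_zero], h6⟩

/-- Cayley-Hamilton for the action of M on the span of the two coordinate forms. -/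
theorem plane_aeval_contractingPoly (x : Fin 5 → ℝ) :
    planeX β (aeval (sigmaFam t).action (contractingPoly β) x) = 0 ∧
    planeY β (aeval (sigmaFam t).action (contractingPoly β) x) = 0 := by
  rw [hβ.aeval_contractingPoly]
  simp only [map_add, map_smul, smul_eq_mul, hβ.planeX_action, hβ.planeY_action]
  constructor <;> ring

theorem plane_eq_zero_of_mem_Kn {x : Fin 5 → ℝ} (hx : x ∈ Kn (sigmaFam t) β) :
    planeX β x = 0 ∧ planeY β x = 0 := by
  obtain ⟨y, rfl⟩ := hx
  rw [hβ.isPrimitiveUnitPisot.pisotPoly_eq, mul_comm, map_mul, Module.End.mul_apply]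
  exact hβ.plane_aeval_contractingPoly _

theorem height_aeval (p : ℝ[X]) (x : Fin 5 → ℝ) :
    height β (aeval (sigmaFam t).action p x) = p.eval β * height β x := by
  induction p using Polynomial.induction_on' with
  | add p q hp hq => simp [hp, hq, add_mul]
  | monomial n a =>
    rw [aeval_monomial, eval_monomial, Module.End.mul_apply, Module.algebraMap_end_apply, map_smul,
      smul_eq_mul, mul_assoc]
    congr 1
    induction n with
    | zero => simp
    | succ n ih =>
      rw [pow_succ', Module.End.mul_apply, hβ.height_action, ih]
      ring

/-- The height is a left eigenvector for β, and β is not a root of the contracting polynomial. -/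
theorem height_eq_zero_of_mem_Kc {x : Fin 5 → ℝ} (hx : x ∈ Kc (sigmaFam t) β) :
    height β x = 0 := by
  have h := hβ.height_aeval (contractingPoly β) x
  rw [LinearMap.mem_ker.mp hx, map_zero, hβ.contractingPoly_eq] at h
  simp only [eval_add, eval_pow, eval_X, eval_mul, eval_C] at h
  have hb := hβ.pos
  have hl := hβ.lt
  have : 0 < β ^ 2 + (β - t) * β + 1 / β := by
    have : 0 < (β - t) * β := mul_pos (by linarith) hb
    positivity
  exact (mul_eq_zero.mp h.symm).resolve_left this.ne'

theorem height_eq_zero_of_mem_Kn {x : Fin 5 → ℝ} (hx : x ∈ Kn (sigmaFam t) β) :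
    height β x = 0 := by
  obtain ⟨y, rfl⟩ := hx
  rw [hβ.height_aeval, hβ.isPrimitiveUnitPisot.pisotPoly_eq]
  simp

theorem plane_piC (x : Fin 5 → ℝ) :
    planeX β (hβ.isPrimitiveUnitPisot.piC x) = planeX β x ∧
    planeY β (hβ.isPrimitiveUnitPisot.piC x) = planeY β x := by
  have hk : x - (hβ.isPrimitiveUnitPisot.piC x : Fin 5 → ℝ) ∈
      Ke (sigmaFam t) β ⊔ Kn (sigmaFam t) β := by
    rw [← Submodule.projectionOnto_apply_eq_zero_iff hβ.isPrimitiveUnitPisot.isCompl_Kc, map_sub,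
      Submodule.projectionOnto_apply_left]
    exact sub_self _
  obtain ⟨y, hy, z, hz, hyz⟩ := Submodule.mem_sup.mp hk
  have e : x = hβ.isPrimitiveUnitPisot.piC x + (y + z) := by rw [hyz]; abel
  have h1 := hβ.plane_eq_zero_of_mem_Ke hy
  have h2 := hβ.plane_eq_zero_of_mem_Kn hz
  constructor
  · conv_rhs => rw [e]
    simp [h1.1, h2.1]
  · conv_rhs => rw [e]
    simp [h1.2, h2.2]

theorem height_piE (x : Fin 5 → ℝ) : height β (hβ.isPrimitiveUnitPisot.piE x) = height β x := by
  have hk : x - (hβ.isPrimitiveUnitPisot.piE x : Fin 5 → ℝ) ∈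
      Kc (sigmaFam t) β ⊔ Kn (sigmaFam t) β := by
    rw [← Submodule.projectionOnto_apply_eq_zero_iff hβ.isPrimitiveUnitPisot.isCompl_Ke, map_sub,
      Submodule.projectionOnto_apply_left]
    exact sub_self _
  obtain ⟨y, hy, z, hz, hyz⟩ := Submodule.mem_sup.mp hk
  have e : x = hβ.isPrimitiveUnitPisot.piE x + (y + z) := by rw [hyz]; abel
  conv_rhs => rw [e]
  simp [hβ.height_eq_zero_of_mem_Kc hy, hβ.height_eq_zero_of_mem_Kn hz]

theorem eq_zero_of_mem_Kc {x : Fin 5 → ℝ} (hx : x ∈ Kc (sigmaFam t) β) (h1 : planeX β x = 0)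
    (h2 : planeY β x = 0) : x = 0 := by
  have h3 := hβ.height_eq_zero_of_mem_Kc hx
  have hb := hβ.pos
  rw [planeX_apply] at h1
  rw [planeY_apply] at h2
  rw [height_apply] at h3
  -- The combination of `height_decomposition` again: the three forms vanish together only if a = b
  -- = c = 0, in the notation there.
  have e1 : x 1 - x 2 + x 3 = 0 := by
    have : (β * (β + 1) + 1 / β + 1 / (β + 1)) * (x 1 - x 2 + x 3) = 0 := by
      field_simp at h1 h2 h3 ⊢
      linear_combination β * h3 - β ^ 2 * (β + 1) * h2 - (β + 1) * h1
    exact (mul_eq_zero.mp this).resolve_left (by positivity)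
  have e0 : x 0 + x 3 = 0 := by linear_combination h2 + (β + 1) * e1
  have e4 : x 4 + x 2 - x 3 = 0 := by linear_combination h1 + 1 / β * e1
  -- Two unknowns, x 2 and x 3, are left; two rows of the quadratic equation for M on the
  -- contracting space give a nonsingular system for them.
  have hp := LinearMap.mem_ker.mp hx
  rw [hβ.aeval_contractingPoly] at hp
  have p2 := congrFun hp 2
  have p3 := congrFun hp 3
  simp [action_apply] at p2 p3
  have hl := hβ.lt
  have hs : 1 < β - t := by linarith
  have hi : 0 < β⁻¹ := by positivity
  set s := β - t
  set p := β⁻¹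
  have q2 : (s + p) * x 2 = (1 + s) * x 3 := by linear_combination p2 - e0 - s * e1
  have q3 : (1 + s) * x 2 = (1 - p) * x 3 := by linear_combination p3 - e1
  have x2 : x 2 = 0 := by
    have : ((1 + s) ^ 2 - (s + p) * (1 - p)) * x 2 = 0 := by
      linear_combination (1 + s) * q3 - (1 - p) * q2
    exact (mul_eq_zero.mp this).resolve_left (by nlinarith)
  have x3 : x 3 = 0 := by
    rw [x2, mul_zero] at q2
    exact (mul_eq_zero.mp q2.symm).resolve_left (by linarith)
  ext i
  fin_cases i
  · simp; linarith
  · simp; linarith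
  · exact x2
  · exact x3
  · simp; linarith

theorem ext_Kc {w w' : Kc (sigmaFam t) β} (h1 : planeX β w = planeX β w')
    (h2 : planeY β w = planeY β w') : w = w' := by
  rw [← sub_eq_zero, ← Submodule.coe_eq_zero]
  refine hβ.eq_zero_of_mem_Kc (w - w').2 ?_ ?_
  · simp [h1]
  · simp [h2]

/-- No two basis vectors have parallel projections, so every face projects to a nondegenerate
parallelogram. -/
theorem cross_ne_zero {i j : Fin 5} (hij : i ≠ j) :
    planeX β (Pi.single i 1) * planeY β (Pi.single j 1) -
      planeX β (Pi.single j 1) * planeY β (Pi.single i 1) ≠ 0 := by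
  have hb := hβ.pos
  have h1 := hβ.one_lt
  have hi : 0 < β⁻¹ := by positivity
  have hi1 : β⁻¹ * β = 1 := by field_simp
  rw [planeX_apply, planeX_apply, planeY_apply, planeY_apply]
  fin_cases i <;> fin_cases j <;> first | exact absurd rfl hij | skip
  all_goals
    simp
    try
      intro h
      ring_nf at h
      nlinarith

end IsDominantRoot

/-- A point of a two-dimensional face. -/
noncomputable def Face.point (F : Face 5 2) (s s' : ℝ) : Fin 5 → ℝ :=
  (fun m => (F.1 m : ℝ)) +
    (s • Pi.single (F.2.letters 0) (1 : ℝ) + s' • Pi.single (F.2.letters 1) (1 : ℝ))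

theorem Face.mem_support {F : Face 5 2} {z : Fin 5 → ℝ} :
    z ∈ F.support ↔ ∃ s ∈ Set.Icc (0 : ℝ) 1, ∃ s' ∈ Set.Icc (0 : ℝ) 1, z = F.point s s' := by
  constructor
  · rintro ⟨t, ht, rfl⟩
    exact ⟨t 0, ht 0, t 1, ht 1, by rw [Fin.sum_univ_two]; rfl⟩
  · rintro ⟨s, hs, s', hs', rfl⟩
    refine ⟨![s, s'], ?_, by rw [Fin.sum_univ_two]; rfl⟩
    intro i
    fin_cases i
    · exact hs
    · exact hs'

theorem exists_linear_combination {a b c d : ℝ} (h : a * d - b * c ≠ 0) (u v : ℝ) :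
    ∃ s s' : ℝ, s * a + s' * b = u ∧ s * c + s' * d = v := by
  refine ⟨(u * d - v * b) / (a * d - b * c), (v * a - u * c) / (a * d - b * c), ?_, ?_⟩
  · rw [div_mul_eq_mul_div, div_mul_eq_mul_div, ← add_div, div_eq_iff h]; ring
  · rw [div_mul_eq_mul_div, div_mul_eq_mul_div, ← add_div, div_eq_iff h]; ring

theorem Face.le_of_forall_Ioo (F : Face 5 2) (g : (Fin 5 → ℝ) →ₗ[ℝ] ℝ) {b : ℝ}
    (h : ∀ s ∈ Set.Ioo (0 : ℝ) 1, ∀ s' ∈ Set.Ioo (0 : ℝ) 1, g (F.point s s') ≤ b) :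
    ∀ s ∈ Set.Icc (0 : ℝ) 1, ∀ s' ∈ Set.Icc (0 : ℝ) 1, g (F.point s s') ≤ b := by
  intro s hs s' hs'
  have hcl : IsClosed {p : ℝ × ℝ | g (F.point p.1 p.2) ≤ b} := by
    refine isClosed_le (g.continuous_of_finiteDimensional.comp ?_) continuous_const
    unfold Face.point
    fun_prop
  have hsub : Set.Ioo (0 : ℝ) 1 ×ˢ Set.Ioo (0 : ℝ) 1 ⊆ {p : ℝ × ℝ | g (F.point p.1 p.2) ≤ b} :=
    fun p hp => h _ hp.1 _ hp.2
  have := closure_minimal hsub hcl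
  rw [closure_prod_eq, closure_Ioo zero_ne_one] at this
  exact this (show (s, s') ∈ _ from ⟨hs, hs'⟩)

theorem WedgeType.letters_ne {k : ℕ} (a : WedgeType 5 k) {i j : Fin k} (h : i ≠ j) :
    a.letters i ≠ a.letters j :=
  fun h' => h ((a.1.orderEmbOfFin a.2).injective h')

/-! ### Projections of faces: interiors, generic points and separation -/

namespace IsDominantRoot

variable {t : ℕ} {β : ℝ} (hβ : IsDominantRoot t β)
include hβ

theorem piC_point_bijective (F : Face 5 2) :
    Function.Bijective fun p : ℝ × ℝ => hβ.isPrimitiveUnitPisot.piC (F.point p.1 p.2) := by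
  set i := F.2.letters 0
  set j := F.2.letters 1
  have hc : planeX β (Pi.single i 1) * planeY β (Pi.single j 1) -
      planeX β (Pi.single j 1) * planeY β (Pi.single i 1) ≠ 0 :=
    hβ.cross_ne_zero (F.2.letters_ne (show (0 : Fin 2) ≠ 1 by decide))
  have hX : ∀ p : ℝ × ℝ, planeX β (hβ.isPrimitiveUnitPisot.piC (F.point p.1 p.2)) =
      planeX β (fun m => (F.1 m : ℝ)) + (p.1 * planeX β (Pi.single i 1) +
        p.2 * planeX β (Pi.single j 1)) := by
    intro p; rw [(hβ.plane_piC _).1, Face.point]; simp [i, j]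
  have hY : ∀ p : ℝ × ℝ, planeY β (hβ.isPrimitiveUnitPisot.piC (F.point p.1 p.2)) =
      planeY β (fun m => (F.1 m : ℝ)) + (p.1 * planeY β (Pi.single i 1) +
        p.2 * planeY β (Pi.single j 1)) := by
    intro p; rw [(hβ.plane_piC _).2, Face.point]; simp [i, j]
  constructor
  · intro p p' h
    have h1 := hX p
    have h2 := hY p
    simp only at h
    rw [h, hX] at h1
    rw [h, hY] at h2
    ext
    · refine mul_left_cancel₀ hc ?_
      linear_combination planeX β (Pi.single j 1) * h2 - planeY β (Pi.single j 1) * h1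
    · refine mul_left_cancel₀ hc ?_
      linear_combination planeY β (Pi.single i 1) * h1 - planeX β (Pi.single i 1) * h2
  · intro w
    obtain ⟨s, s', h1, h2⟩ := exists_linear_combination hc
      (planeX β w - planeX β (fun m => (F.1 m : ℝ))) (planeY β w - planeY β (fun m => (F.1 m : ℝ)))
    refine ⟨(s, s'), hβ.ext_Kc ?_ ?_⟩
    · rw [hX]; linear_combination h1
    · rw [hY]; linear_combination h2

/-- The interior of the projection of a face. -/
theorem interior_piC_support (F : Face 5 2) :
    interior (hβ.isPrimitiveUnitPisot.piC '' F.support) =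
      (fun p : ℝ × ℝ => hβ.isPrimitiveUnitPisot.piC (F.point p.1 p.2)) ''
        (Set.Ioo 0 1 ×ˢ Set.Ioo 0 1) := by
  set i := F.2.letters 0
  set j := F.2.letters 1
  set π := hβ.isPrimitiveUnitPisot.piC
  let ψ : ℝ × ℝ →ₗ[ℝ] Kc (sigmaFam t) β :=
    (LinearMap.toSpanSingleton ℝ _ (π (Pi.single i 1))).comp (LinearMap.fst ℝ ℝ ℝ) +
    (LinearMap.toSpanSingleton ℝ _ (π (Pi.single j 1))).comp (LinearMap.snd ℝ ℝ ℝ)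
  have hψ : ∀ p : ℝ × ℝ, π (F.point p.1 p.2) = π (fun m => (F.1 m : ℝ)) + ψ p := by
    intro p; simp [Face.point, ψ, i, j]
  have hbij := hβ.piC_point_bijective F
  have hfun : (fun p : ℝ × ℝ => π (F.point p.1 p.2)) =
      (fun w => π (fun m => (F.1 m : ℝ)) + w) ∘ ψ := funext hψ
  have hψb : Function.Bijective ψ := by
    change Function.Bijective (fun p : ℝ × ℝ => π (F.point p.1 p.2)) at hbij
    rw [hfun] at hbij
    exact ((Equiv.addLeft (π (fun m => (F.1 m : ℝ)))).bijective.of_comp_iff' ψ).mp hbij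
  let Φ : ℝ × ℝ ≃ₜ Kc (sigmaFam t) β :=
    (LinearEquiv.ofBijective ψ hψb).toContinuousLinearEquiv.toHomeomorph.trans
      (Homeomorph.addLeft (π (fun m => (F.1 m : ℝ))))
  have hΦ : (fun p : ℝ × ℝ => π (F.point p.1 p.2)) = Φ := by
    rw [hfun]; rfl
  have himg : π '' F.support = Φ '' (Set.Icc 0 1 ×ˢ Set.Icc 0 1) := by
    rw [← hΦ]
    ext w
    constructor
    · rintro ⟨z, hz, rfl⟩
      obtain ⟨s, hs, s', hs', rfl⟩ := Face.mem_support.mp hz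
      exact ⟨(s, s'), ⟨hs, hs'⟩, rfl⟩
    · rintro ⟨⟨s, s'⟩, ⟨hs, hs'⟩, rfl⟩
      exact ⟨_, Face.mem_support.mpr ⟨s, hs, s', hs', rfl⟩, rfl⟩
  rw [himg, ← Φ.image_interior, interior_prod_eq, interior_Icc, hΦ]

/-- If the interiors of the projections of two faces meet, there are interior points of the faces
with the same projection, whose images under `M` lie over a point of the horizontal axis which is
not the coordinate of a lattice point. -/
theorem exists_point_of_not_disjoint {F G : Face 5 2}
    (h : ¬ Disjoint (interior (hβ.isPrimitiveUnitPisot.piC '' F.support))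
      (interior (hβ.isPrimitiveUnitPisot.piC '' G.support))) :
    ∃ s ∈ Set.Ioo (0 : ℝ) 1, ∃ s' ∈ Set.Ioo (0 : ℝ) 1, ∃ u ∈ Set.Ioo (0 : ℝ) 1,
      ∃ u' ∈ Set.Ioo (0 : ℝ) 1, planeX β (F.point s s') = planeX β (G.point u u') ∧
        planeY β (F.point s s') = planeY β (G.point u u') ∧
        ∀ y : Fin 5 → ℤ, planeX β (fun m => (y m : ℝ)) ≠
          planeX β ((sigmaFam t).action (F.point s s')) := by
  have hb := hβ.pos
  set π := hβ.isPrimitiveUnitPisot.piC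
  set O := interior (π '' F.support) ∩ interior (π '' G.support)
  have hO : IsOpen O := isOpen_interior.inter isOpen_interior
  have hne : O.Nonempty := Set.not_disjoint_iff_nonempty_inter.mp h
  -- By `planeX_action` the horizontal coordinate after M is -1/β times the vertical one before. A
  -- nonzero linear form maps the open overlap to an open set, which cannot consist of the countably
  -- many values coming from lattice points.
  let ℓ : Kc (sigmaFam t) β →ₗ[ℝ] ℝ := (planeY β).comp (Kc (sigmaFam t) β).subtype
  have hℓ : Function.Surjective ℓ := by
    refine LinearMap.surjective ?_
    intro h0
    have h1 : ℓ (π (Pi.single 0 1)) = 0 := by rw [h0]; rfl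
    have h2 : ℓ (π (Pi.single 0 1)) = planeY β (Pi.single 0 1) := (hβ.plane_piC _).2
    rw [h1, planeY_apply] at h2
    simp at h2
  have hopen := ℓ.isOpenMap_of_finiteDimensional hℓ O hO
  have hcount : (Set.range fun y : Fin 5 → ℤ => -β * planeX β (fun m => (y m : ℝ))).Countable :=
    Set.countable_range _
  obtain ⟨v, ⟨w, hw, rfl⟩, hv⟩ := (hcount.dense_compl ℝ).inter_open_nonempty _ hopen
    (hne.image _) |>.imp fun v hv => hv
  obtain ⟨hw1, hw2⟩ := hw
  rw [hβ.interior_piC_support] at hw1 hw2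
  obtain ⟨⟨s, s'⟩, ⟨hs, hs'⟩, h1⟩ := hw1
  obtain ⟨⟨u, u'⟩, ⟨hu, hu'⟩, h2⟩ := hw2
  refine ⟨s, hs, s', hs', u, hu, u', hu', ?_, ?_, ?_⟩
  · rw [← (hβ.plane_piC (F.point s s')).1, ← (hβ.plane_piC (G.point u u')).1]
    exact congrArg (fun w : Kc (sigmaFam t) β => planeX β w) (h1.trans h2.symm)
  · rw [← (hβ.plane_piC (F.point s s')).2, ← (hβ.plane_piC (G.point u u')).2]
    exact congrArg (fun w : Kc (sigmaFam t) β => planeY β w) (h1.trans h2.symm)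
  · intro y hy
    refine hv ⟨y, ?_⟩
    simp only
    rw [hy, hβ.planeX_action, ← h1]
    simp only [ℓ, LinearMap.comp_apply, Submodule.subtype_apply]
    rw [(hβ.plane_piC (F.point s s')).2]
    field_simp

/-- Faces whose projections have disjoint interiors are separated by a line. -/
theorem exists_separating_line {F G : Face 5 2}
    (h : Disjoint (interior (hβ.isPrimitiveUnitPisot.piC '' F.support))
      (interior (hβ.isPrimitiveUnitPisot.piC '' G.support))) :
    ∃ κ μ c : ℝ, (κ ≠ 0 ∨ μ ≠ 0) ∧
      (∀ s ∈ Set.Icc (0 : ℝ) 1, ∀ s' ∈ Set.Icc (0 : ℝ) 1,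
        κ * planeX β (F.point s s') + μ * planeY β (F.point s s') ≤ c) ∧
      ∀ s ∈ Set.Icc (0 : ℝ) 1, ∀ s' ∈ Set.Icc (0 : ℝ) 1,
        c ≤ κ * planeX β (G.point s s') + μ * planeY β (G.point s s') := by
  set π := hβ.isPrimitiveUnitPisot.piC
  have hconv : ∀ F : Face 5 2, Convex ℝ (interior (π '' F.support)) := by
    intro F
    refine (Convex.linear_image ?_ π).interior
    intro x hx y hy a b ha hb hab
    obtain ⟨s, hs, s', hs', rfl⟩ := Face.mem_support.mp hx
    obtain ⟨u, hu, u', hu', rfl⟩ := Face.mem_support.mp hy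
    refine Face.mem_support.mpr ⟨a * s + b * u, convex_Icc 0 1 hs hu ha hb hab, a * s' + b * u',
      convex_Icc 0 1 hs' hu' ha hb hab, ?_⟩
    ext m
    simp only [Face.point, Pi.add_apply, Pi.smul_apply, smul_eq_mul]
    linear_combination (F.1 m : ℝ) * hab
  -- The functional separates the open parallelograms strictly; continuity extends the weak
  -- inequalities to their edges and vertices.
  obtain ⟨f, c, hf, hg⟩ := geometric_hahn_banach_open_open (hconv F) isOpen_interior (hconv G)
    isOpen_interior h
  set g : (Fin 5 → ℝ) →ₗ[ℝ] ℝ := f.toLinearMap.comp π with hg0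
  -- The vectors e₄ and e₀ have plane coordinates (1, 0) and (0, 1).
  have hval : ∀ x : Fin 5 → ℝ,
      g x = g (Pi.single 4 1) * planeX β x + g (Pi.single 0 1) * planeY β x := by
    intro x
    have : π x = planeX β x • π (Pi.single 4 1) + planeY β x • π (Pi.single 0 1) := by
      rw [← map_smul, ← map_smul, ← map_add]
      refine hβ.ext_Kc ?_ ?_
      · rw [(hβ.plane_piC _).1, (hβ.plane_piC _).1]
        simp [planeX_apply]
      · rw [(hβ.plane_piC _).2, (hβ.plane_piC _).2]
        simp [planeY_apply]
    have h1 := congrArg f this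
    rw [map_add, map_smul, map_smul, smul_eq_mul, smul_eq_mul, mul_comm,
      mul_comm (planeY β x)] at h1
    exact h1
  have hmem : ∀ (F : Face 5 2), ∀ s ∈ Set.Ioo (0 : ℝ) 1, ∀ s' ∈ Set.Ioo (0 : ℝ) 1,
      π (F.point s s') ∈ interior (π '' F.support) := by
    intro F s hs s' hs'
    rw [hβ.interior_piC_support]
    exact ⟨(s, s'), ⟨hs, hs'⟩, rfl⟩
  have half : (1 / 2 : ℝ) ∈ Set.Ioo (0 : ℝ) 1 := by constructor <;> norm_num
  have hf' : ∀ s ∈ Set.Ioo (0 : ℝ) 1, ∀ s' ∈ Set.Ioo (0 : ℝ) 1, g (F.point s s') < c :=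
    fun s hs s' hs' => hf _ (hmem F s hs s' hs')
  have hg' : ∀ s ∈ Set.Ioo (0 : ℝ) 1, ∀ s' ∈ Set.Ioo (0 : ℝ) 1, c < g (G.point s s') :=
    fun s hs s' hs' => hg _ (hmem G s hs s' hs')
  refine ⟨g (Pi.single 4 1), g (Pi.single 0 1), c, ?_, ?_, ?_⟩
  · by_contra! h0
    have h1 := hf' _ half _ half
    have h2 := hg' _ half _ half
    rw [hval, h0.1, h0.2] at h1 h2
    linarith
  · intro s hs s' hs'
    rw [← hval]
    exact F.le_of_forall_Ioo g (fun s hs s' hs' => (hf' s hs s' hs').le) s hs s' hs'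
  · intro s hs s' hs'
    rw [← hval]
    have := G.le_of_forall_Ioo (-g) (b := -c)
      (fun s hs s' hs' => neg_le_neg (hg' s hs s' hs').le) s hs s' hs'
    exact neg_le_neg_iff.mp this

end IsDominantRoot

/-! ### Decompositions of the images of the letters -/

/-- `σ(a) = p b s` with `p` consisting of `m` letters `0`; the vector is the abelianization of
`s`. -/
inductive Step (t : ℕ) : Fin 5 → Fin 5 → ℕ → (Fin 5 → ℤ) → Prop
  | last (a : Fin 5) : Step t a (a + 1) (![t + 1, 0, 0, t, 0] a) 0
  | zero {m m' : ℕ} (h : m + m' = t) : Step t 0 0 m (Pi.single 1 1 + (m' : ℤ) • Pi.single 0 1)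
  | three {m m' : ℕ} (h : m + m' + 1 = t) :
      Step t 3 0 m (Pi.single 4 1 + (m' : ℤ) • Pi.single 0 1)

theorem abel_replicate_zero (m : ℕ) :
    abel (List.replicate m (0 : Fin 5)) = (m : ℤ) • Pi.single 0 1 := by
  ext i
  by_cases h : i = 0
  · subst h; simp [abel]
  · simp [abel, h, List.count_replicate, Ne.symm h]

theorem mulVec_single (t : ℕ) (a : Fin 5) :
    (sigmaFam t).incidence.mulVec (Pi.single a 1) = abel ((sigmaFam t).img a) := by
  ext i
  simp [Substitution.incidence, abel]

theorem exists_step (t : ℕ) (a : Fin 5) (p : Fin ((sigmaFam t).img a).length) :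
    ∃ s, Step t a (((sigmaFam t).img a).get p) p s ∧
      abel (((sigmaFam t).img a).take p) = (p : ℤ) • Pi.single 0 1 ∧
      (sigmaFam t).incidence.mulVec (Pi.single a 1) =
        (p : ℤ) • Pi.single 0 1 + Pi.single (((sigmaFam t).img a).get p) 1 + s := by
  rw [mulVec_single]
  have key : ∀ (n : ℕ) (b : Fin 5) (w : List (Fin 5)), w = List.replicate n 0 ++ [b] →
      ∀ p : Fin w.length, ((p : ℕ) = n ∧ w.get p = b ∨ (p : ℕ) < n ∧ w.get p = 0) ∧
        abel (w.take p) = (p : ℤ) • Pi.single 0 1 ∧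
        abel w = (n : ℤ) • Pi.single 0 1 + Pi.single b 1 := by
    rintro n b w rfl ⟨p, hp⟩
    have hp' : p < n + 1 := by simpa using hp
    refine ⟨?_, ?_, ?_⟩
    · rcases (Nat.lt_succ_iff.mp hp').eq_or_lt with rfl | h
      · left; simp
      · right; simp [h]
    · have : (List.replicate n (0 : Fin 5) ++ [b]).take p = List.replicate p 0 := by
        rw [List.take_append_of_le_length (by simp; omega), List.take_replicate]
        congr 1; omega
      rw [this, abel_replicate_zero]
    · rw [← abel_replicate_zero]
      ext i
      by_cases h : i = b
      · subst h; simp [abel]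
      · simp [abel, h, Ne.symm h]
  -- Addition in `Fin 5` wraps around, so the formula includes the image of the letter 4, which is
  -- 0.
  have hw : (sigmaFam t).img a = List.replicate (![t + 1, 0, 0, t, 0] a) 0 ++ [a + 1] := by
    fin_cases a <;> rfl
  obtain ⟨h1, h2, h3⟩ := key _ _ _ hw p
  rcases h1 with ⟨h, hg⟩ | ⟨h, hg⟩
  · rw [hg, h2, h3, h]
    exact ⟨0, Step.last a, rfl, by simp⟩
  · rw [hg, h2, h3]
    have ha : a = 0 ∨ a = 3 := by
      revert h
      fin_cases a <;> simp
    rcases ha with rfl | rfl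
    · obtain ⟨m, hm⟩ := Nat.exists_eq_add_of_le (Nat.lt_succ_iff.mp h)
      refine ⟨_, Step.zero hm.symm, rfl, ?_⟩
      ext i
      simp [hm]
      ring
    · obtain ⟨m, hm⟩ := Nat.exists_eq_add_of_lt h
      refine ⟨_, Step.three hm.symm, rfl, ?_⟩
      simp at hm
      ext i
      simp [hm]
      ring

/-- The possible pairs of a letter `a` and a letter `b` of `σ(a)`. -/
def Occurs (a b : Fin 5) : Prop := b = a + 1 ∨ b = 0 ∧ (a = 0 ∨ a = 3)

instance : DecidableRel Occurs := fun _ _ => inferInstanceAs (Decidable (_ ∨ _))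

theorem Step.occurs {t : ℕ} {a b : Fin 5} {m : ℕ} {s : Fin 5 → ℤ} (h : Step t a b m s) :
    Occurs a b := by
  cases h
  · exact Or.inl rfl
  · exact Or.inr ⟨rfl, Or.inl rfl⟩
  · exact Or.inr ⟨rfl, Or.inr rfl⟩

/-- Only the letter 0 can occur more than once in σ(a). -/
theorem Step.length_unique {t : ℕ} {a b : Fin 5} {m m' : ℕ} {s s' : Fin 5 → ℤ}
    (h : Step t a b m s) (h' : Step t a b m' s') (hb : b ≠ 0) : m = m' := by
  cases h
  · generalize hc : a + 1 = c at h'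
    cases h'
    · rfl
    · exact absurd hc (by decide)
    · exact absurd hc (by decide)
  · exact absurd rfl hb
  · exact absurd rfl hb

/-- The excluded orders are the odd permutations. Adding 1 modulo 5 shifts an increasing triple
cyclically at most. Choosing 0 from σ(0) keeps the order, and choosing 0 from σ(3) with the other
letters distinct makes 3 the last letter, again a cyclic shift. -/
theorem not_odd_arrangement : ∀ a b : Fin 5, Occurs a b → ∀ a', a < a' → ∀ b', Occurs a' b' →
    ∀ a'', a' < a'' → ∀ b'', Occurs a'' b'' →
      ¬ (b < b'' ∧ b'' < b') ∧ ¬ (b'' < b' ∧ b' < b) ∧ ¬ (b' < b ∧ b < b'') := by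
  decide

set_option synthInstance.maxHeartbeats 400000 in
set_option synthInstance.maxSize 100000 in
set_option maxRecDepth 100000 in
-- Two decompositions with the same set of distinct middle letters take the same letter from each
-- image; then only the position of a letter 0 can differ.
theorem arrangement_unique : ∀ a b : Fin 5, Occurs a b → ∀ c, Occurs a c → ∀ a', a < a' →
    ∀ b', Occurs a' b' → ∀ c', Occurs a' c' → ∀ a'', a' < a'' → ∀ b'', Occurs a'' b'' →
    ∀ c'', Occurs a'' c'' → b ≠ b' → b ≠ b'' → b' ≠ b'' → c ≠ c' → c ≠ c'' → c' ≠ c'' →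
    (c = b ∨ c = b' ∨ c = b'') → (c' = b ∨ c' = b' ∨ c' = b'') →
    (c'' = b ∨ c'' = b' ∨ c'' = b'') → c = b ∧ c' = b' ∧ c'' = b'' := by
  decide

set_option synthInstance.maxHeartbeats 400000 in
set_option synthInstance.maxSize 100000 in
set_option maxRecDepth 100000 in
-- The passage to complementary letters. Usually each complementary letter is shifted by 1. If the
-- middle letter 0 comes from σ(0), then 4 is absent from the source and takes the place of the
-- predecessor of 1; if it comes from σ(3), then 4 takes the place of the predecessor of 4. These
-- exceptions produce the vertical pieces.
theorem transverse_pieces : ∀ a b : Fin 5, Occurs a b → ∀ a', a < a' → ∀ b', Occurs a' b' →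
    ∀ a'', a' < a'' → ∀ b'', Occurs a'' b'' → b ≠ b' → b ≠ b'' → b' ≠ b'' →
    ∀ i j : Fin 5, i < j → i ≠ b → i ≠ b' → i ≠ b'' → j ≠ b → j ≠ b' → j ≠ b'' →
    ∃ k l : Fin 5, k ≠ l ∧ (k ≠ a ∧ k ≠ a' ∧ k ≠ a'') ∧ (l ≠ a ∧ l ≠ a' ∧ l ≠ a'') ∧
      (i = k + 1 ∧ j = l + 1 ∧ b = a + 1 ∧ b' = a' + 1 ∧ b'' = a'' + 1 ∨
       i = 1 ∧ k = 4 ∧ j = l + 1 ∧ (a = 0 ∧ b = 0 ∧ b' = a' + 1 ∧ b'' = a'' + 1) ∨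
       j = 4 ∧ l = 4 ∧ i = k + 1 ∧ (a = 3 ∧ b = 0 ∧ b' = a' + 1 ∧ b'' = a'' + 1 ∨
         a' = 3 ∧ b' = 0 ∧ b = a + 1 ∧ b'' = a'' + 1 ∨
         a'' = 3 ∧ b'' = 0 ∧ b = a + 1 ∧ b' = a' + 1)) := by
  decide

/-! ### The coefficients of the dual map -/

theorem WedgeType.letters_lt {k : ℕ} (a : WedgeType 5 k) {i j : Fin k} (h : i < j) :
    a.letters i < a.letters j :=
  (a.1.orderEmbOfFin a.2).strictMono h

theorem WedgeType.mem_iff {k : ℕ} (a : WedgeType 5 k) {x : Fin 5} :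
    x ∈ a.1 ↔ ∃ i, a.letters i = x := by
  have := a.1.range_orderEmbOfFin a.2
  rw [← Finset.mem_coe, ← this]
  rfl

theorem Decomp.occurs {t k : ℕ} {b : WedgeType 5 k} (c : Decomp (sigmaFam t) b) (i : Fin k) :
    Occurs (b.letters i) (c.mid i) := by
  obtain ⟨s, hs, -⟩ := exists_step t (b.letters i) (c i)
  exact hs.occurs

theorem Decomp.prefixSum_eq {t k : ℕ} {b : WedgeType 5 k} (c : Decomp (sigmaFam t) b) :
    c.prefixSum = (∑ i, ((c i : ℕ) : ℤ)) • Pi.single 0 1 := by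
  rw [Decomp.prefixSum, Finset.sum_smul]
  refine Finset.sum_congr rfl fun i _ => ?_
  obtain ⟨s, -, hs, -⟩ := exists_step t (b.letters i) (c i)
  exact hs

theorem sign_eq_one_of_occurs {a b : WedgeType 5 3} {τ : Equiv.Perm (Fin 3)}
    (h : ∀ i, Occurs (b.letters i) (a.letters (τ i))) : Equiv.Perm.sign τ = 1 := by
  have key : ∀ τ : Equiv.Perm (Fin 3), Equiv.Perm.sign τ = 1 ∨
      (τ 0 < τ 2 ∧ τ 2 < τ 1) ∨ (τ 2 < τ 1 ∧ τ 1 < τ 0) ∨ (τ 1 < τ 0 ∧ τ 0 < τ 2) := by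
    decide
  have h1 := not_odd_arrangement _ _ (h 0) _ (b.letters_lt (show (0 : Fin 3) < 1 by decide))
    _ (h 1) _ (b.letters_lt (show (1 : Fin 3) < 2 by decide)) _ (h 2)
  rcases key τ with h2 | h2 | h2 | h2
  · exact h2
  · exact absurd ⟨a.letters_lt h2.1, a.letters_lt h2.2⟩ h1.1
  · exact absurd ⟨a.letters_lt h2.1, a.letters_lt h2.2⟩ h1.2.1
  · exact absurd ⟨a.letters_lt h2.1, a.letters_lt h2.2⟩ h1.2.2

/-- The middle letters of a decomposition are only permuted evenly. -/
theorem Decomp.sign_eq_one {t : ℕ} {a b : WedgeType 5 3} (c : Decomp (sigmaFam t) b)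
    {τ : Equiv.Perm (Fin 3)} (h : c.mid = a.letters ∘ τ) : Equiv.Perm.sign τ = 1 :=
  sign_eq_one_of_occurs fun i => by rw [← Function.comp_apply (f := a.letters), ← h]; exact c.occurs i

/-- The middle letters and the lengths of the prefixes determine a decomposition. -/
theorem Decomp.eq_of_prefixSum_eq {t : ℕ} {a b : WedgeType 5 3} {c c' : Decomp (sigmaFam t) b}
    {τ τ' : Equiv.Perm (Fin 3)} (h : c.mid = a.letters ∘ τ) (h' : c'.mid = a.letters ∘ τ')
    (hp : c.prefixSum = c'.prefixSum) : c = c' := by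
  have hne : ∀ {i j : Fin 3}, i ≠ j → c.mid i ≠ c.mid j := by
    intro i j hij
    rw [h]
    exact a.letters_ne (τ.injective.ne hij)
  have hne' : ∀ {i j : Fin 3}, i ≠ j → c'.mid i ≠ c'.mid j := by
    intro i j hij
    rw [h']
    exact a.letters_ne (τ'.injective.ne hij)
  have hmem : ∀ i, c'.mid i = c.mid 0 ∨ c'.mid i = c.mid 1 ∨ c'.mid i = c.mid 2 := by
    intro i
    obtain ⟨j, hj⟩ := τ.surjective (τ' i)
    have : c'.mid i = c.mid j := by
      rw [h, h', Function.comp_apply, Function.comp_apply, hj]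
    rw [this]
    fin_cases j <;> simp
  obtain ⟨e0, e1, e2⟩ := arrangement_unique _ _ (c.occurs 0) _ (c'.occurs 0) _
    (b.letters_lt (show (0 : Fin 3) < 1 by decide)) _ (c.occurs 1) _ (c'.occurs 1) _
    (b.letters_lt (show (1 : Fin 3) < 2 by decide)) _ (c.occurs 2) _ (c'.occurs 2)
    (hne (by decide)) (hne (by decide)) (hne (by decide)) (hne' (by decide)) (hne' (by decide))
    (hne' (by decide)) (hmem 0) (hmem 1) (hmem 2)
  have hlen : ∀ i, c'.mid i = c.mid i → c.mid i ≠ 0 → (c i : ℕ) = c' i := by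
    intro i hi h0
    obtain ⟨s, hs, -⟩ := exists_step t (b.letters i) (c i)
    obtain ⟨s', hs', -⟩ := exists_step t (b.letters i) (c' i)
    change Step t _ (c.mid i) _ _ at hs
    change Step t _ (c'.mid i) _ _ at hs'
    rw [hi] at hs'
    exact hs.length_unique hs' h0
  have l0 := hlen 0 e0
  have l1 := hlen 1 e1
  have l2 := hlen 2 e2
  have n01 := hne (show (0 : Fin 3) ≠ 1 by decide)
  have n02 := hne (show (0 : Fin 3) ≠ 2 by decide)
  have n12 := hne (show (1 : Fin 3) ≠ 2 by decide)
  -- All prefixes are powers of 0, so only the sum of their lengths is known. At most one middle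
  -- letter is 0, and the other two lengths are already determined, hence so is the third.
  have hs : (c 0 : ℕ) + c 1 + c 2 = (c' 0 : ℕ) + c' 1 + c' 2 := by
    rw [c.prefixSum_eq, c'.prefixSum_eq, Fin.sum_univ_three, Fin.sum_univ_three] at hp
    have := congrFun hp 0
    simp at this
    exact_mod_cast this
  funext i
  apply Fin.ext
  by_cases z0 : c.mid 0 = 0
  · have l1 := l1 (by rw [← z0]; exact n01.symm)
    have l2 := l2 (by rw [← z0]; exact n02.symm)
    fin_cases i
    · exact (by omega : (c 0 : ℕ) = c' 0)
    · exact l1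
    · exact l2
  · have l0 := l0 z0
    by_cases z1 : c.mid 1 = 0
    · have l2 := l2 (by rw [← z1]; exact n12.symm)
      fin_cases i
      · exact l0
      · exact (by omega : (c 1 : ℕ) = c' 1)
      · exact l2
    · have l1 := l1 z1
      fin_cases i
      · exact l0
      · exact l1
      · exact (by omega : (c 2 : ℕ) = c' 2)

theorem sigmaFam_isUnit_det (t : ℕ) : IsUnit (sigmaFam t).incidence.det := by
  have : (sigmaFam t).incidence.det = 1 := by
    rw [sigmaFam_incidence]
    simp [Matrix.det_succ_row_zero, Fin.sum_univ_succ, Fin.succAbove]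
  rw [this]
  exact isUnit_one

/-- There is a decomposition of the image of the second face which yields the first one. -/
def Precedes (t : ℕ) (F G : Face 5 3) : Prop :=
  ∃ (c : Decomp (sigmaFam t) G.2) (τ : Equiv.Perm (Fin 3)), c.mid = F.2.letters ∘ τ ∧
    (sigmaFam t).incidence.mulVec G.1 + c.prefixSum = F.1

open Classical in
-- At most one decomposition contributes, with a unique permutation, and that permutation is even.
theorem dualExtension_single (t : ℕ) (F G : Face 5 3) :
    dualExtension (sigmaFam t) 3 (Finsupp.single F 1) G = if Precedes t F G then 1 else 0 := by
  rw [dualExtension_apply _ (sigmaFam_isUnit_det t)]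
  simp only [extension, Face.toChain, Finsupp.linearCombination_single, one_smul,
    Finsupp.finsetSum_apply]
  have key : ∀ c : Decomp (sigmaFam t) G.2,
      wedgeFace ((sigmaFam t).incidence.mulVec G.1 + c.prefixSum) c.mid F =
        if (∃ τ : Equiv.Perm (Fin 3), c.mid = F.2.letters ∘ τ) ∧
          (sigmaFam t).incidence.mulVec G.1 + c.prefixSum = F.1 then 1 else 0 := by
    intro c
    simp only [wedgeFace, Finsupp.finsetSum_apply]
    rw [Finset.sum_eq_single F.2]
    · split_ifs with h
      · obtain ⟨⟨τ, hτ⟩, hx⟩ := h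
        rw [Finset.sum_eq_single τ]
        · rw [if_pos hτ, c.sign_eq_one hτ, hx]
          simp
        · intro τ' _ hne
          rw [if_neg]
          · rfl
          · intro h'
            refine hne (Equiv.ext fun i => (F.2.1.orderEmbOfFin F.2.2).injective ?_)
            exact congrFun (h'.symm.trans hτ) i
        · simp
      · refine Finset.sum_eq_zero fun τ _ => ?_
        split_ifs with h'
        · rw [Finsupp.single_apply, if_neg]
          intro he
          exact h ⟨⟨τ, h'⟩, congrArg Prod.fst he⟩
        · rfl
    · intro b _ hb
      refine Finset.sum_eq_zero fun τ _ => ?_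
      split_ifs
      · rw [Finsupp.single_apply, if_neg]
        intro he
        exact hb (congrArg Prod.snd he)
      · rfl
    · simp
  rw [Finset.sum_congr rfl fun c _ => key c]
  split_ifs with h
  · obtain ⟨c, τ, hc, hx⟩ := h
    rw [Finset.sum_eq_single c]
    · rw [if_pos ⟨⟨τ, hc⟩, hx⟩]
    · intro c' _ hne
      rw [if_neg]
      rintro ⟨⟨τ', hc'⟩, hx'⟩
      refine hne (Decomp.eq_of_prefixSum_eq hc' hc ?_)
      exact add_left_cancel (hx'.trans hx.symm)
    · simp
  · refine Finset.sum_eq_zero fun c _ => ?_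
    rw [if_neg]
    rintro ⟨⟨τ, hc⟩, hx⟩
    exact h ⟨c, τ, hc, hx⟩

/-- The dual face which is mapped to a face by the Poincaré map. -/
def Face.transverse (F : Face 5 2) : Face 5 3 :=
  (F.1 - (F.2.compl (j := 3) rfl).vec, F.2.compl (j := 3) rfl)

theorem poincare_apply (P : DualChain 5 3) (V : Face 5 2) :
    poincare (rfl : 3 + 2 = 5) P V = V.transverse.2.sgn * P V.transverse := by
  induction P using Finsupp.induction_linear with
  | zero => simp
  | add P Q hP hQ => rw [map_add, Finsupp.add_apply, hP, hQ, Finsupp.add_apply, mul_add]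
  | single F m =>
    have : poincare (rfl : 3 + 2 = 5) (Finsupp.single F m) =
        m • Finsupp.single (F.1 + F.2.vec, F.2.compl rfl) F.2.sgn := by
      simp [poincare]
    rw [this, Finsupp.smul_apply, Finsupp.single_apply, Finsupp.single_apply]
    have he : (F.1 + F.2.vec, F.2.compl (rfl : 3 + 2 = 5)) = V ↔ F = V.transverse := by
      constructor
      · rintro rfl
        simp [Face.transverse, WedgeType.compl_compl]
      · intro h
        rw [h]
        simp [Face.transverse, WedgeType.compl_compl]
    by_cases hF : F = V.transverse
    · rw [if_pos (he.mpr hF), if_pos hF, ← hF, smul_eq_mul, mul_comm]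
    · rw [if_neg (fun h => hF (he.mp h)), if_neg hF]
      simp

open Classical in
theorem geometricDual_apply (t : ℕ) (U V : Face 5 2) :
    geometricDual (sigmaFam t) (rfl : 3 + 2 = 5) U.toChain V =
      V.transverse.2.sgn * U.transverse.2.sgn *
        if Precedes t U.transverse V.transverse then 1 else 0 := by
  have h1 : (poincare (rfl : 3 + 2 = 5)).symm U.toChain =
      U.transverse.2.sgn • Finsupp.single U.transverse 1 := by
    simp [poincare, Face.toChain, Face.transverse]
  rw [geometricDual, LinearMap.comp_apply, LinearMap.comp_apply, LinearEquiv.coe_coe,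
    LinearEquiv.coe_coe, h1, map_smul, map_smul, Finsupp.smul_apply, poincare_apply,
    dualExtension_single, smul_eq_mul]
  ring

theorem WedgeType.sgn_eq (a : WedgeType 5 3) : a.sgn = 1 ∨ a.sgn = -1 :=
  neg_one_pow_eq_or ℤ _

theorem precedes_of_mem_support {t : ℕ} {U V : Face 5 2}
    (h : V ∈ (geometricDual (sigmaFam t) (rfl : 3 + 2 = 5) U.toChain).support) :
    Precedes t U.transverse V.transverse := by
  classical
  rw [Finsupp.mem_support_iff, geometricDual_apply] at h
  by_contra hp
  rw [if_neg hp, mul_zero] at h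
  exact h rfl

theorem isGeometric_geometricDual (t : ℕ) (U : Face 5 2) :
    IsGeometric (geometricDual (sigmaFam t) (rfl : 3 + 2 = 5) U.toChain) := by
  classical
  intro V hV
  rw [geometricDual_apply, if_pos (precedes_of_mem_support hV)]
  rcases WedgeType.sgn_eq V.transverse.2 with h | h <;>
    rcases WedgeType.sgn_eq U.transverse.2 with h' | h' <;> simp [h, h']

/-! ### Primitivity of the exterior power -/

theorem incidence_nonneg (t : ℕ) (a b : Fin 5) : 0 ≤ (sigmaFam t).incidence b a :=
  Int.natCast_nonneg _

theorem occurs_of_incidence_ne_zero {t : ℕ} {a b : Fin 5} (h : (sigmaFam t).incidence b a ≠ 0) :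
    Occurs a b := by
  rw [sigmaFam_incidence] at h
  revert h
  fin_cases a <;> fin_cases b <;> first | exact fun _ => (by decide) | simp

theorem dualMatrix_apply (t : ℕ) (b a : WedgeType 5 3) :
    dualMatrix (sigmaFam t) 3 b a = ∑ τ : Equiv.Perm (Fin 3), ((Equiv.Perm.sign τ : ℤˣ) : ℤ) *
      ∏ i, (sigmaFam t).incidence (a.letters (τ i)) (b.letters i) := by
  rw [dualMatrix, Matrix.of_apply, ← Matrix.det_transpose, Matrix.det_apply']
  rfl

/-- The terms of the expansion of a minor are nonnegative. -/
theorem minor_term_eq (t : ℕ) (b a : WedgeType 5 3) (τ : Equiv.Perm (Fin 3)) :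
    ((Equiv.Perm.sign τ : ℤˣ) : ℤ) * ∏ i, (sigmaFam t).incidence (a.letters (τ i)) (b.letters i) =
      ∏ i, (sigmaFam t).incidence (a.letters (τ i)) (b.letters i) := by
  by_cases h : ∃ i, (sigmaFam t).incidence (a.letters (τ i)) (b.letters i) = 0
  · obtain ⟨i, hi⟩ := h
    rw [Finset.prod_eq_zero (Finset.mem_univ i) hi, mul_zero]
  · push Not at h
    rw [sign_eq_one_of_occurs fun i => occurs_of_incidence_ne_zero (h i)]
    simp

theorem dualMatrix_nonneg (t : ℕ) (b a : WedgeType 5 3) : 0 ≤ dualMatrix (sigmaFam t) 3 b a := by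
  rw [dualMatrix_apply]
  refine Finset.sum_nonneg fun τ _ => ?_
  rw [minor_term_eq]
  exact Finset.prod_nonneg fun i _ => incidence_nonneg t _ _

/-- By `minor_term_eq` nothing cancels in the minor, so a single nonzero term is enough; the map f
supplies it. -/
theorem dualMatrix_pos {t : ℕ} {b a : WedgeType 5 3} (f : Fin 5 → Fin 5)
    (hf : ∀ x ∈ b.1, 0 < (sigmaFam t).incidence (f x) x) (h : b.1.image f = a.1) :
    0 < dualMatrix (sigmaFam t) 3 b a := by
  have hinj : Set.InjOn f b.1 := Finset.injOn_of_card_image_eq (by rw [h, a.2, b.2])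
  have hmem : ∀ i, b.letters i ∈ b.1 := fun i => b.mem_iff.mpr ⟨i, rfl⟩
  have hex : ∀ i, ∃ j, a.letters j = f (b.letters i) := fun i =>
    a.mem_iff.mp (by rw [← h]; exact Finset.mem_image_of_mem f (hmem i))
  choose τ hτ using hex
  have hτi : Function.Injective τ := by
    intro i j hij
    have : f (b.letters i) = f (b.letters j) := by rw [← hτ, ← hτ, hij]
    exact (b.1.orderEmbOfFin b.2).injective (hinj (hmem i) (hmem j) this)
  rw [dualMatrix_apply]
  refine Finset.sum_pos' (fun τ _ => ?_)
    ⟨Equiv.ofBijective τ (Finite.injective_iff_bijective.mp hτi), Finset.mem_univ _, ?_⟩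
  · rw [minor_term_eq]
    exact Finset.prod_nonneg fun i _ => incidence_nonneg t _ _
  · rw [minor_term_eq]
    refine Finset.prod_pos fun i _ => ?_
    rw [Equiv.ofBijective_apply, hτ]
    exact hf _ (hmem i)

theorem dualMatrix_isPrimitive (t : ℕ) : (dualMatrix (sigmaFam t) 3).IsPrimitive := by
  let e : Fin 10 → WedgeType 5 3 := ![⟨{0, 1, 2}, rfl⟩, ⟨{0, 1, 3}, rfl⟩, ⟨{0, 1, 4}, rfl⟩,
    ⟨{0, 2, 3}, rfl⟩, ⟨{0, 2, 4}, rfl⟩, ⟨{0, 3, 4}, rfl⟩, ⟨{1, 2, 3}, rfl⟩, ⟨{1, 2, 4}, rfl⟩,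
    ⟨{1, 3, 4}, rfl⟩, ⟨{2, 3, 4}, rfl⟩]
  -- The successors of a triple are its images under x ↦ x + 1 and under the same map with 0 fixed;
  -- only entries of M that are positive for every t are used.
  refine isPrimitive_of_adj (dualMatrix_nonneg t) e (by decide)
    ![[6, 3], [7, 4], [0], [8, 5], [1], [2], [9], [3], [4], [5]] ?_ (k := 14) (by norm_num)
    (by decide)
  intro i j hj
  have key : ∀ i, ∀ j ∈ (![[6, 3], [7, 4], [0], [8, 5], [1], [2], [9], [3], [4], [5]] :
      Fin 10 → List (Fin 10)) i, (e i).1.image (fun x => x + 1) = (e j).1 ∨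
        (e i).1.image (fun x => if x = 0 then 0 else x + 1) = (e j).1 := by
    decide
  have h1 : ∀ x : Fin 5, 0 < (sigmaFam t).incidence (x + 1) x := by
    intro x
    rw [sigmaFam_incidence]
    fin_cases x <;> simp
  rcases key i j hj with h | h
  · exact dualMatrix_pos _ (fun x _ => h1 x) h
  · refine dualMatrix_pos _ (fun x _ => ?_) h
    rcases eq_or_ne x 0 with rfl | hx
    · rw [if_pos rfl, sigmaFam_incidence]
      simp
    · rw [if_neg hx]
      exact h1 x

theorem dualExtension_nonneg (t : ℕ) (F G : Face 5 3) :
    0 ≤ dualExtension (sigmaFam t) 3 (Finsupp.single F 1) G := by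
  classical
  rw [dualExtension_single]
  split_ifs <;> simp

/-! ### The pieces of the image of a face -/

/-- The edge of type `i` at the origin is replaced by edges which are, up to `M`, the edges of type
`k` at the points `o`. -/
inductive EdgePiece (t : ℕ) : Fin 5 → Fin 5 → (Fin 5 → ℤ) → Prop
  | sloped (k : Fin 5) : EdgePiece t (k + 1) k 0
  | left {m : ℕ} (h : m ≤ t) : EdgePiece t 1 4 (Pi.single 1 1 + (m : ℤ) • Pi.single 0 1)
  | right {m : ℕ} (h : m < t) : EdgePiece t 4 4 (Pi.single 4 1 + (m : ℤ) • Pi.single 0 1)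

theorem Step.eq_zero {t : ℕ} {a b : Fin 5} {m : ℕ} {s : Fin 5 → ℤ} (h : Step t a b m s)
    (hb : b = a + 1) : s = 0 := by
  cases h
  · rfl
  · exact absurd hb (by decide)
  · exact absurd hb (by decide)

/-- The suffix after the chosen letter 0 becomes the base point of a vertical piece. There are t + 1
such pieces on the left of an edge of type 1 but only t on the right of an edge of type 4, whence
the different bounds for m. -/
theorem Step.lift {t : ℕ} {a b : Fin 5} {m : ℕ} {s : Fin 5 → ℤ} (h : Step t a b m s)
    (ha : a = 0) (hb : b = 0) : EdgePiece t 1 4 s := by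
  cases h
  · subst ha; exact absurd hb (by decide)
  · exact EdgePiece.left (by omega)
  · exact absurd ha (by decide)

theorem Step.drop {t : ℕ} {a b : Fin 5} {m : ℕ} {s : Fin 5 → ℤ} (h : Step t a b m s)
    (ha : a = 3) (hb : b = 0) : EdgePiece t 4 4 s := by
  cases h
  · subst ha; exact absurd hb (by decide)
  · exact absurd ha (by decide)
  · exact EdgePiece.right (by omega)

theorem WedgeType.vec_eq {k : ℕ} (a : WedgeType 5 k) :
    a.vec = ∑ i, (Pi.single (a.letters i) (1 : ℤ) : Fin 5 → ℤ) := by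
  rw [WedgeType.vec, ← Finset.sum_coe_sort]
  exact (Equiv.sum_comp (a.1.orderIsoOfFin a.2).toEquiv
    (fun x : a.1 => (Pi.single (x : Fin 5) (1 : ℤ) : Fin 5 → ℤ))).symm

theorem Face.fst_eq (F : Face 5 2) : F.1 = F.transverse.1 + F.transverse.2.vec := by
  simp [Face.transverse]

/-- The faces of the image of a face `U` are, up to `M`, products of pieces of its edges. -/
theorem Precedes.exists_pieces {t : ℕ} {U V : Face 5 2}
    (h : Precedes t U.transverse V.transverse) :
    ∃ k l o o', k ≠ l ∧ V.2.1 = {k, l} ∧ EdgePiece t (U.2.letters 0) k o ∧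
      EdgePiece t (U.2.letters 1) l o' ∧ (sigmaFam t).incidence.mulVec V.1 = U.1 + o + o' := by
  obtain ⟨c, τ, hc, hx⟩ := h
  have hsteps := fun n => exists_step t (V.transverse.2.letters n) (c n)
  choose s hs hs1 hs2 using hsteps
  have hne : ∀ {i j : Fin 3}, i ≠ j → c.mid i ≠ c.mid j := by
    intro i j hij
    rw [hc]
    exact U.transverse.2.letters_ne (τ.injective.ne hij)
  have hU : ∀ m n, U.2.letters m ≠ c.mid n := by
    intro m n he
    have h1 : U.2.letters m ∈ U.2.1 := U.2.mem_iff.mpr ⟨m, rfl⟩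
    have h2 : U.2.letters m ∈ U.transverse.2.1 := by
      rw [he, hc]; exact U.transverse.2.mem_iff.mpr ⟨_, rfl⟩
    exact (Finset.mem_compl.mp h2) h1
  have hV : ∀ k, k ≠ V.transverse.2.letters 0 ∧ k ≠ V.transverse.2.letters 1 ∧ k ≠ V.transverse.2.letters 2 → k ∈ V.2.1 := by
    rintro k ⟨h0, h1, h2⟩
    by_contra hk
    have : k ∈ V.transverse.2.1 := Finset.mem_compl.mpr hk
    obtain ⟨n, rfl⟩ := V.transverse.2.mem_iff.mp this
    fin_cases n
    · exact h0 rfl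
    · exact h1 rfl
    · exact h2 rfl
  -- The Poincaré map adds the letters of the type to the base point, so whole words σ(b) appear;
  -- prefixes and middle letters are absorbed into the base point of U and only the suffixes remain.
  have hsum : (sigmaFam t).incidence.mulVec V.1 = U.1 + (s 0 + s 1 + s 2) := by
    rw [V.fst_eq, U.fst_eq, Matrix.mulVec_add, ← hx, V.transverse.2.vec_eq, Decomp.prefixSum,
      Matrix.mulVec_sum, U.transverse.2.vec_eq]
    have h1 : ∑ i, (Pi.single (U.transverse.2.letters i) (1 : ℤ) : Fin 5 → ℤ) =
        ∑ i, Pi.single (c.mid i) (1 : ℤ) := by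
      rw [hc]
      exact (Equiv.sum_comp τ fun i =>
        (Pi.single (U.transverse.2.letters i) (1 : ℤ) : Fin 5 → ℤ)).symm
    have h2 : ∀ n, (sigmaFam t).incidence.mulVec (Pi.single (V.transverse.2.letters n) 1) =
        abel (((sigmaFam t).img (V.transverse.2.letters n)).take (c n)) + Pi.single (c.mid n) 1 + s n := by
      intro n
      rw [hs1, hs2]
      rfl
    rw [h1, Finset.sum_congr rfl fun n _ => h2 n]
    simp only [Fin.sum_univ_three]
    abel
  obtain ⟨k, l, hkl, hk, hl, hcase⟩ := transverse_pieces _ _ (c.occurs 0) _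
    (V.transverse.2.letters_lt (show (0 : Fin 3) < 1 by decide)) _ (c.occurs 1) _
    (V.transverse.2.letters_lt (show (1 : Fin 3) < 2 by decide)) _ (c.occurs 2)
    (hne (by decide)) (hne (by decide)) (hne (by decide)) _ _
    (U.2.letters_lt (show (0 : Fin 2) < 1 by decide)) (hU 0 0) (hU 0 1) (hU 0 2)
    (hU 1 0) (hU 1 1) (hU 1 2)
  have hset : V.2.1 = {k, l} := by
    symm
    refine Finset.eq_of_subset_of_card_le ?_ ?_
    · intro x hx
      rcases Finset.mem_insert.mp hx with rfl | hx
      · exact hV _ hk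
      · rw [Finset.mem_singleton.mp hx]; exact hV _ hl
    · rw [V.2.2, Finset.card_pair hkl]
  have hz : ∀ n, c.mid n = V.transverse.2.letters n + 1 → s n = 0 := fun n hn => (hs n).eq_zero hn
  have hlift : ∀ n, V.transverse.2.letters n = 0 → c.mid n = 0 → EdgePiece t 1 4 (s n) := by
    intro n h0 h1
    exact (hs n).lift h0 h1
  have hdrop : ∀ n, V.transverse.2.letters n = 3 → c.mid n = 0 → EdgePiece t 4 4 (s n) := by
    intro n h0 h1
    exact (hs n).drop h0 h1
  rcases hcase with ⟨hi, hj, h0, h1, h2⟩ | ⟨hi, rfl, hj, ha0, h0, h1, h2⟩ |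
    ⟨hj, rfl, hi, hcase⟩
  · refine ⟨k, l, 0, 0, hkl, hset, ?_, ?_, ?_⟩
    · rw [hi]; exact EdgePiece.sloped k
    · rw [hj]; exact EdgePiece.sloped l
    · rw [hsum, hz 0 h0, hz 1 h1, hz 2 h2]; simp
  · refine ⟨4, l, s 0, 0, hkl, hset, ?_, ?_, ?_⟩
    · rw [hi]; exact hlift 0 ha0 h0
    · rw [hj]; exact EdgePiece.sloped l
    · rw [hsum, hz 1 h1, hz 2 h2]; simp
  · rcases hcase with ⟨ha0, h0, h1, h2⟩ | ⟨ha0, h0, h1, h2⟩ | ⟨ha0, h0, h1, h2⟩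
    · refine ⟨k, 4, 0, s 0, hkl, hset, ?_, ?_, ?_⟩
      · rw [hi]; exact EdgePiece.sloped k
      · rw [hj]; exact hdrop 0 ha0 h0
      · rw [hsum, hz 1 h1, hz 2 h2]; simp
    · refine ⟨k, 4, 0, s 1, hkl, hset, ?_, ?_, ?_⟩
      · rw [hi]; exact EdgePiece.sloped k
      · rw [hj]; exact hdrop 1 ha0 h0
      · rw [hsum, hz 0 h1, hz 2 h2]; simp
    · refine ⟨k, 4, 0, s 2, hkl, hset, ?_, ?_, ?_⟩
      · rw [hi]; exact EdgePiece.sloped k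
      · rw [hj]; exact hdrop 2 ha0 h0
      · rw [hsum, hz 0 h1, hz 1 h2]; simp

/-! ### Lattice points -/

/-- A lattice point as a real vector. -/
def toReal (y : Fin 5 → ℤ) : Fin 5 → ℝ := fun m => (y m : ℝ)

theorem toReal_add (y z : Fin 5 → ℤ) : toReal (y + z) = toReal y + toReal z := by
  ext; simp [toReal]

theorem toReal_sub (y z : Fin 5 → ℤ) : toReal (y - z) = toReal y - toReal z := by
  ext; simp [toReal]

theorem toReal_smul (m : ℤ) (y : Fin 5 → ℤ) : toReal (m • y) = (m : ℝ) • toReal y := by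
  ext; simp [toReal]

theorem toReal_zero : toReal 0 = 0 := by
  ext; simp [toReal]

theorem toReal_single (a : Fin 5) : toReal (Pi.single a 1) = Pi.single a 1 := by
  ext i
  by_cases h : i = a
  · subst h; simp [toReal]
  · simp [toReal, h]

theorem toReal_mulVec (t : ℕ) (y : Fin 5 → ℤ) :
    toReal ((sigmaFam t).incidence.mulVec y) = (sigmaFam t).action (toReal y) := by
  rw [action_apply, sigmaFam_incidence]
  ext i
  fin_cases i <;> simp [toReal, Matrix.mulVec, dotProduct, Fin.sum_univ_five]

/-- `1` for the edges with negative horizontal coordinate. -/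
def leftward : Fin 5 → ℤ := ![0, 1, 0, 1, 0]

/-- The left end of the edge of type `i` at the origin. -/
def leftEnd (i : Fin 5) : Fin 5 → ℤ := leftward i • Pi.single i 1

/-- The vector from the left to the right end of an edge. -/
def edgeVec (i : Fin 5) : Fin 5 → ℤ := (1 - 2 * leftward i) • Pi.single i 1

theorem planeX_edgeVec {β : ℝ} (i : Fin 5) : planeX β (toReal (edgeVec i)) = width β i := by
  rw [edgeVec, toReal_smul, toReal_single, map_smul, planeX_apply]
  fin_cases i <;> simp [leftward, width]

theorem planeY_edgeVec {β : ℝ} (i : Fin 5) : planeY β (toReal (edgeVec i)) = rise β i := by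
  rw [edgeVec, toReal_smul, toReal_single, map_smul, planeY_apply]
  fin_cases i <;> simp [leftward, rise]

section

variable {t : ℕ} {β : ℝ} (hβ : IsDominantRoot t β)
include hβ

/-- The points of the pieces of an edge, relative to its left end. -/
theorem EdgePiece.point {i k : Fin 5} {o : Fin 5 → ℤ} (h : EdgePiece t i k o) (hi : i ≠ 0) {u : ℝ}
    (hu : u ∈ Set.Ioo (0 : ℝ) 1) {q r : ℝ}
    (hq : q = planeX β (toReal o + u • (sigmaFam t).action (Pi.single k 1) - toReal (leftEnd i)))
    (hr : r = planeY β (toReal o + u • (sigmaFam t).action (Pi.single k 1) - toReal (leftEnd i))) :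
    (i = k + 1 ∧ o = 0 ∧ 0 < q ∧ q < width β i ∧ r = lift t i + slope t β i * q) ∨
    (i = 1 ∧ k = 4 ∧ ∃ m : ℕ, m ≤ t ∧ o = Pi.single 1 1 + (m : ℤ) • Pi.single 0 1 ∧ q = 0 ∧
      r = m + u) ∨
    (i = 4 ∧ k = 4 ∧ ∃ m : ℕ, m < t ∧ o = Pi.single 4 1 + (m : ℤ) • Pi.single 0 1 ∧
      q = width β i ∧ r = m + u) := by
  obtain ⟨hu0, hu1⟩ := hu
  have hb := hβ.pos
  have hc := hβ.cast_eq
  cases h with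
  | sloped k =>
    left
    refine ⟨rfl, rfl, ?_⟩
    have hw := width_pos hβ hi
    -- Edges of types 1 and 3 point to the left and are run through backwards, hence 1 - u.
    have hs : q = width β (k + 1) * (if leftward (k + 1) = 1 then 1 - u else u) ∧
        r = lift t (k + 1) + slope t β (k + 1) * q := by
      rw [hr, hq]
      simp only [leftEnd, toReal_zero, toReal_smul, toReal_single, zero_add, map_sub, map_smul,
        hβ.planeX_action, hβ.planeY_action, planeX_apply, planeY_apply]
      fin_cases k <;> simp [leftward, width, lift, slope] at hi ⊢
      all_goals
        simp at hc
        try rw [hc]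
        constructor <;> field_simp <;> ring
    refine ⟨?_, ?_, hs.2⟩
    · rw [hs.1]
      refine mul_pos hw ?_
      split_ifs <;> linarith
    · rw [hs.1]
      refine mul_lt_of_lt_one_right hw ?_
      split_ifs <;> linarith
  | @left m h =>
    right; left
    refine ⟨rfl, rfl, m, h, rfl, ?_, ?_⟩
    · rw [hq]
      simp only [leftEnd, toReal_add, toReal_smul, toReal_single, map_add, map_sub, map_smul,
        hβ.planeX_action, planeX_apply, planeY_apply]
      simp [leftward]
    · rw [hr]
      simp only [leftEnd, toReal_add, toReal_smul, toReal_single, map_add, map_sub, map_smul,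
        hβ.planeY_action, planeX_apply, planeY_apply]
      simp [leftward]
      ring
  | @right m h =>
    right; right
    refine ⟨rfl, rfl, m, h, rfl, ?_, ?_⟩
    · rw [hq]
      simp only [leftEnd, toReal_add, toReal_smul, toReal_single, map_add, map_sub, map_smul,
        hβ.planeX_action, planeX_apply, planeY_apply]
      simp [leftward, width]
    · rw [hr]
      simp only [leftEnd, toReal_add, toReal_smul, toReal_single, map_add, map_sub, map_smul,
        hβ.planeY_action, planeX_apply, planeY_apply]
      simp [leftward]

theorem EdgePiece.onDeformed {i k : Fin 5} {o : Fin 5 → ℤ} (h : EdgePiece t i k o) (hi : i ≠ 0)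
    {u : ℝ} (hu : u ∈ Set.Ioo (0 : ℝ) 1) {q r : ℝ}
    (hq : q = planeX β (toReal o + u • (sigmaFam t).action (Pi.single k 1) - toReal (leftEnd i)))
    (hr : r = planeY β (toReal o + u • (sigmaFam t).action (Pi.single k 1) - toReal (leftEnd i))) :
    OnDeformed (width β i) (slope t β i) (lift t i) (drop t i) q r ∧
      (k ≠ 4 → 0 < q ∧ q < width β i) := by
  rcases h.point hβ hi hu hq hr with ⟨-, -, h1, h2, h3⟩ | ⟨rfl, rfl, m, hm, -, h1, h2⟩ |
    ⟨rfl, rfl, m, hm, -, h1, h2⟩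
  · exact ⟨Or.inl ⟨q, h1, h2, rfl, h3⟩, fun _ => ⟨h1, h2⟩⟩
  · have : (m : ℝ) ≤ t := by exact_mod_cast hm
    refine ⟨Or.inr (Or.inl ⟨h1, ?_, ?_⟩), fun h => absurd rfl h⟩
    · rw [h2]; have := hu.1; positivity
    · rw [h2]; simp [lift]; linarith [hu.2]
  · have : (m : ℝ) + 1 ≤ t := by exact_mod_cast hm
    refine ⟨Or.inr (Or.inr ⟨h1, ?_, ?_⟩), fun h => absurd rfl h⟩
    · rw [h2]; simp [lift, slope, width, drop]; have := hu.1; positivity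
    · rw [h2]; simp [lift, slope, width]; linarith [hu.2]

end

theorem EdgePiece.of_zero {t : ℕ} {i k : Fin 5} {o : Fin 5 → ℤ} (h : EdgePiece t i k o)
    (hi : i = 0) : k = 4 ∧ o = 0 := by
  cases h with
  | sloped k => exact ⟨by revert hi; revert k; decide, rfl⟩
  | left => exact absurd hi (by decide)
  | right => exact absurd hi (by decide)

theorem EdgePiece.of_ne {t : ℕ} {i k : Fin 5} {o : Fin 5 → ℤ} (h : EdgePiece t i k o)
    (hk : k ≠ 4) : i = k + 1 ∧ o = 0 := by
  cases h with
  | sloped k => exact ⟨rfl, rfl⟩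
  | left => exact absurd rfl hk
  | right => exact absurd rfl hk

/-! ### The image of a face -/

/-- `U` is replaced by `V` and others, and `(q, r)` are the coordinates of the image under `M` of an
interior point of `V`. -/
structure IsPiece (t : ℕ) (β : ℝ) (U V : Face 5 2) (q r : ℝ) (k l : Fin 5) (o o' : Fin 5 → ℤ)
    (u u' : ℝ) : Prop where
  ne : k ≠ l
  type_eq : V.2.1 = {k, l}
  piece : EdgePiece t (U.2.letters 0) k o
  piece' : EdgePiece t (U.2.letters 1) l o'
  mulVec_eq : (sigmaFam t).incidence.mulVec V.1 = U.1 + o + o'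
  mem : u ∈ Set.Ioo (0 : ℝ) 1
  mem' : u' ∈ Set.Ioo (0 : ℝ) 1
  eqX : q = planeX β (toReal U.1 + (toReal o + u • (sigmaFam t).action (Pi.single k 1)) +
    (toReal o' + u' • (sigmaFam t).action (Pi.single l 1)))
  eqY : r = planeY β (toReal U.1 + (toReal o + u • (sigmaFam t).action (Pi.single k 1)) +
    (toReal o' + u' • (sigmaFam t).action (Pi.single l 1)))

theorem exists_isPiece {t : ℕ} (β : ℝ) {U V : Face 5 2} (h : Precedes t U.transverse V.transverse)
    {s s' : ℝ} (hs : s ∈ Set.Ioo (0 : ℝ) 1) (hs' : s' ∈ Set.Ioo (0 : ℝ) 1) :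
    ∃ k l o o' u u', IsPiece t β U V (planeX β ((sigmaFam t).action (V.point s s')))
      (planeY β ((sigmaFam t).action (V.point s s'))) k l o o' u u' := by
  obtain ⟨k, l, o, o', hkl, htype, h1, h2, hM⟩ := h.exists_pieces
  have hpt : ∃ u ∈ Set.Ioo (0 : ℝ) 1, ∃ u' ∈ Set.Ioo (0 : ℝ) 1,
      V.point s s' = toReal V.1 + (u • Pi.single k 1 + u' • Pi.single l 1) := by
    have h0 : V.2.letters 0 ∈ V.2.1 := V.2.mem_iff.mpr ⟨0, rfl⟩
    have h1 : V.2.letters 1 ∈ V.2.1 := V.2.mem_iff.mpr ⟨1, rfl⟩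
    have hne := V.2.letters_ne (show (0 : Fin 2) ≠ 1 by decide)
    simp only [htype, Finset.mem_insert, Finset.mem_singleton] at h0 h1
    rcases h0 with h0 | h0 <;> rcases h1 with h1 | h1
    · exact absurd (h0.trans h1.symm) hne
    · exact ⟨s, hs, s', hs', by rw [Face.point, h0, h1]; rfl⟩
    · exact ⟨s', hs', s, hs, by rw [Face.point, h0, h1, add_comm (s • _)]; rfl⟩
    · exact absurd (h0.trans h1.symm) hne
  obtain ⟨u, hu, u', hu', hp⟩ := hpt
  have : (sigmaFam t).action (V.point s s') =
      toReal U.1 + (toReal o + u • (sigmaFam t).action (Pi.single k 1)) +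
        (toReal o' + u' • (sigmaFam t).action (Pi.single l 1)) := by
    rw [hp, map_add, map_add, map_smul, map_smul, ← toReal_mulVec, hM, toReal_add, toReal_add]
    abel
  exact ⟨k, l, o, o', u, u', hkl, htype, h1, h2, hM, hu, hu', by rw [this], by rw [this]⟩

/-- The vertices of a face. -/
def Face.IsVertex (U : Face 5 2) (p : Fin 5 → ℤ) : Prop :=
  ∃ ε ε' : ℤ, (ε = 0 ∨ ε = 1) ∧ (ε' = 0 ∨ ε' = 1) ∧
    p = U.1 + (ε • Pi.single (U.2.letters 0) 1 + ε' • Pi.single (U.2.letters 1) 1)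

/-- The height over `q` of the sloped part of the deformed edge of type `i` with left end `p`. -/
noncomputable def deformed (t : ℕ) (β : ℝ) (p : Fin 5 → ℤ) (i : Fin 5) (q : ℝ) : ℝ :=
  planeY β (toReal p) + lift t i + slope t β i * (q - planeX β (toReal p))

/-- `(p, i)` is an edge of `U` over the point `q`. -/
structure Face.HasEdge (U : Face 5 2) (β : ℝ) (p : Fin 5 → ℤ) (i : Fin 5) (q : ℝ) : Prop where
  ne : i ≠ 0
  left : U.IsVertex p
  right : U.IsVertex (p + edgeVec i)
  lt : planeX β (toReal p) < q
  gt : q < planeX β (toReal p) + width β i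

theorem leftward_eq (i : Fin 5) : leftward i = 0 ∨ leftward i = 1 := by
  fin_cases i <;> simp [leftward]

theorem one_sub_leftward_eq (i : Fin 5) : 1 - leftward i = 0 ∨ 1 - leftward i = 1 := by
  rcases leftward_eq i with h | h <;> simp [h]

theorem sigmaFam_mulVec_injective (t : ℕ) :
    Function.Injective (sigmaFam t).incidence.mulVec := by
  intro x y h
  have hu := sigmaFam_isUnit_det t
  have h2 := congrArg (sigmaFam t).incidence⁻¹.mulVec h
  rwa [Matrix.mulVec_mulVec, Matrix.mulVec_mulVec, Matrix.nonsing_inv_mul _ hu,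
    Matrix.one_mulVec, Matrix.one_mulVec] at h2

/-! ### Deformed edges around a face and the preservation of their order -/

section

variable {t : ℕ} {β : ℝ} (hβ : IsDominantRoot t β)
include hβ

/-- The image under `M` of a point of a piece of `U` lies between the deformed edges of `U`. -/
theorem IsPiece.exists_edges {U V : Face 5 2} {q r u u' : ℝ} {k l : Fin 5} {o o' : Fin 5 → ℤ}
    (h : IsPiece t β U V q r k l o o' u u') (hq : ∀ y, planeX β (toReal y) ≠ q) :
    (∃ p i, U.HasEdge β p i q ∧ deformed t β p i q < r) ∧
      ∃ p i, U.HasEdge β p i q ∧ r < deformed t β p i q := by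
  obtain ⟨hkl, -, h1, h2, -, hu, hu', hqe, hre⟩ := h
  have hij := U.2.letters_lt (show (0 : Fin 2) < 1 by decide)
  have hj : U.2.letters 1 ≠ 0 := (lt_of_le_of_lt (Fin.zero_le _) hij).ne'
  have vertex : ∀ ε ε' : ℤ, (ε = 0 ∨ ε = 1) → (ε' = 0 ∨ ε' = 1) → ∀ p,
      p = U.1 + (ε • Pi.single (U.2.letters 0) 1 + ε' • Pi.single (U.2.letters 1) 1) →
      U.IsVertex p := fun ε ε' hε hε' p hp => ⟨ε, ε', hε, hε', hp⟩
  generalize U.2.letters 0 = i at *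
  generalize U.2.letters 1 = j at *
  set L := U.1 + leftEnd i + leftEnd j with hL
  have v1 : U.IsVertex L := vertex _ _ (leftward_eq i) (leftward_eq j) _ (by
    rw [hL, leftEnd, leftEnd]; abel)
  have v2 : U.IsVertex (L + edgeVec i) := vertex _ _ (one_sub_leftward_eq i) (leftward_eq j) _ (by
    rw [hL, leftEnd, leftEnd, edgeVec]; module)
  have v3 : U.IsVertex (L + edgeVec j) := vertex _ _ (leftward_eq i) (one_sub_leftward_eq j) _ (by
    rw [hL, leftEnd, leftEnd, edgeVec]; module)
  have v4 : U.IsVertex (L + edgeVec i + edgeVec j) :=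
    vertex _ _ (one_sub_leftward_eq i) (one_sub_leftward_eq j) _ (by
      rw [hL, leftEnd, leftEnd, edgeVec, edgeVec]; module)
  have v4' : U.IsVertex (L + edgeVec j + edgeVec i) := by rwa [add_right_comm]
  have xi : ∀ p m, planeX β (toReal (p + edgeVec m)) = planeX β (toReal p) + width β m := by
    intro p m; rw [toReal_add, map_add, planeX_edgeVec]
  have yi : ∀ p m, planeY β (toReal (p + edgeVec m)) = planeY β (toReal p) + rise β m := by
    intro p m; rw [toReal_add, map_add, planeY_edgeVec]
  set q₁ := planeX β (toReal o + u • (sigmaFam t).action (Pi.single k 1) - toReal (leftEnd i))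
    with hq₁
  set r₁ := planeY β (toReal o + u • (sigmaFam t).action (Pi.single k 1) - toReal (leftEnd i))
    with hr₁
  set q₂ := planeX β (toReal o' + u' • (sigmaFam t).action (Pi.single l 1) - toReal (leftEnd j))
    with hq₂
  set r₂ := planeY β (toReal o' + u' • (sigmaFam t).action (Pi.single l 1) - toReal (leftEnd j))
    with hr₂
  have eq : q = planeX β (toReal L) + (q₁ + q₂) := by
    rw [hqe, hq₁, hq₂, hL]; simp only [toReal_add, map_add, map_sub]; ring
  have er : r = planeY β (toReal L) + (r₁ + r₂) := by
    rw [hre, hr₁, hr₂, hL]; simp only [toReal_add, map_add, map_sub]; ring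
  -- With a vertical edge, the image lies between the deformed edge of type j and its translate by
  -- one unit upwards.
  rcases eq_or_ne i 0 with hi | hi
  · obtain ⟨rfl, rfl⟩ := h1.of_zero hi
    subst hi
    obtain ⟨h3, h4, h5⟩ : 0 < q₂ ∧ q₂ < width β j ∧ r₂ = lift t j + slope t β j * q₂ := by
      rcases h2.point hβ hj hu' hq₂ hr₂ with ⟨-, -, h⟩ | ⟨-, h, -⟩ | ⟨-, h, -⟩
      · exact h
      · exact absurd h.symm hkl
      · exact absurd h.symm hkl
    have e1 : q₁ = 0 := by
      rw [hq₁]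
      simp only [leftEnd, toReal_zero, toReal_smul, toReal_single, map_add, map_sub, map_smul,
        hβ.planeX_action, planeX_apply, planeY_apply]
      simp [leftward]
    have e2 : r₁ = u := by
      rw [hr₁]
      simp only [leftEnd, toReal_zero, toReal_smul, toReal_single, map_add, map_sub, map_smul,
        hβ.planeY_action, planeX_apply, planeY_apply]
      simp [leftward]
    rw [e1, zero_add] at eq
    rw [e2, h5] at er
    have hw : width β 0 = 0 := rfl
    have hr0 : rise β 0 = 1 := rfl
    refine ⟨⟨L, j, ⟨hj, v1, v3, by linarith, by linarith⟩, ?_⟩,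
      L + edgeVec 0, j, ⟨hj, v2, v4, by rw [xi, hw]; linarith, by rw [xi, hw]; linarith⟩, ?_⟩
    · rw [deformed, er, eq, add_sub_cancel_left]
      linarith [hu.1]
    · rw [deformed, er, eq, xi, yi, hw, hr0, add_zero, add_sub_cancel_left]
      linarith [hu.2]
  · have d1 := h1.onDeformed hβ hi hu hq₁ hr₁
    have d2 := h2.onDeformed hβ hj hu' hq₂ hr₂
    have hwi := width_pos hβ hi
    have hwj := width_pos hβ hj
    -- At least one factor is sloped, since vertical pieces have type 4 and the two types differ.
    have hne : 0 < q₁ ∧ q₁ < width β i ∨ 0 < q₂ ∧ q₂ < width β j := by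
      by_cases hk : k = 4
      · exact Or.inr (d2.2 fun hl => hkl (hk.trans hl.symm))
      · exact Or.inl (d1.2 hk)
    have hi4 : i ≠ 4 := by
      rintro rfl
      exact (by decide : ∀ j : Fin 5, ¬ 4 < j) j hij
    have hdi : drop t i = 0 := by fin_cases i <;> simp [drop] at hi4 ⊢
    have hlj : lift t j = 0 := by
      have h4 : j ≠ 1 := by
        rintro rfl
        exact hi ((by decide : ∀ i : Fin 5, i < 1 → i = 0) i hij)
      fin_cases j <;> simp [lift] at h4 ⊢
    -- Genericity of q: the point does not lie over a vertex where one of the boundary paths turns.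
    have g1 : q₁ + q₂ ≠ width β i := fun h => hq (L + edgeVec i) (by rw [xi, eq, h])
    have g2 : q₁ + q₂ ≠ width β j := fun h => hq (L + edgeVec j) (by rw [xi, eq, h])
    obtain ⟨hlow, hup, hpos, hlt⟩ := deformed_bounds (slope_lt hβ hi hij) hwi hwj hdi hlj d1.1 d2.1
      hne (lift_nonneg t i) (drop_nonneg t j) g1 g2
    have hri := rise_eq hβ hi
    have hrj := rise_eq hβ hj
    constructor
    · rcases hlow with ⟨h3, h4⟩ | ⟨h3, h4⟩
      · refine ⟨L, j, ⟨hj, v1, v3, by linarith, by linarith⟩, ?_⟩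
        rw [deformed, er, eq, add_sub_cancel_left]
        linarith
      · refine ⟨L + edgeVec j, i, ⟨hi, v3, v4', by rw [xi]; linarith, by rw [xi]; linarith⟩, ?_⟩
        rw [deformed, er, eq, xi, yi, hrj, add_sub_add_left_eq_sub]
        linarith
    · rcases hup with ⟨h3, h4⟩ | ⟨h3, h4⟩
      · refine ⟨L, i, ⟨hi, v1, v2, by linarith, by linarith⟩, ?_⟩
        rw [deformed, er, eq, add_sub_cancel_left]
        linarith
      · refine ⟨L + edgeVec i, j, ⟨hj, v2, v4, by rw [xi]; linarith, by rw [xi]; linarith⟩, ?_⟩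
        rw [deformed, er, eq, xi, yi, hri, add_sub_add_left_eq_sub]
        linarith

/-- A piece of an edge is determined by the coordinates of its points, up to horizontal
translation of points of sloped pieces. -/
theorem EdgePiece.unique {i k k₁ : Fin 5} {o o₁ : Fin 5 → ℤ} (h : EdgePiece t i k o)
    (h₁ : EdgePiece t i k₁ o₁) (hi : i ≠ 0) {u u₁ q r q₁ r₁ : ℝ} (hu : u ∈ Set.Ioo (0 : ℝ) 1)
    (hu₁ : u₁ ∈ Set.Ioo (0 : ℝ) 1)
    (hq : q = planeX β (toReal o + u • (sigmaFam t).action (Pi.single k 1) - toReal (leftEnd i)))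
    (hr : r = planeY β (toReal o + u • (sigmaFam t).action (Pi.single k 1) - toReal (leftEnd i)))
    (hq₁ : q₁ =
      planeX β (toReal o₁ + u₁ • (sigmaFam t).action (Pi.single k₁ 1) - toReal (leftEnd i)))
    (hr₁ : r₁ =
      planeY β (toReal o₁ + u₁ • (sigmaFam t).action (Pi.single k₁ 1) - toReal (leftEnd i)))
    (hc : i ≠ 4 ∧ (q = 0 ↔ q₁ = 0) ∧ (q = 0 → r = r₁) ∨
      i ≠ 1 ∧ (q = width β i ↔ q₁ = width β i) ∧ (q = width β i → r = r₁)) :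
    k = k₁ ∧ o = o₁ := by
  -- Vertical pieces are stacked unit segments; the open interval for u makes m the integer part of
  -- the height.
  have cast_eq : ∀ {m m₁ : ℕ}, (m : ℝ) + u = m₁ + u₁ → m = m₁ := by
    intro m m₁ h
    have h3 : (m : ℝ) < m₁ + 1 := by linarith [hu.1, hu₁.2]
    have h4 : (m₁ : ℝ) < m + 1 := by linarith [hu.2, hu₁.1]
    have h3 : m < m₁ + 1 := by exact_mod_cast h3
    have h4 : m₁ < m + 1 := by exact_mod_cast h4
    omega
  rcases h.point hβ hi hu hq hr with ⟨a1, a2, a3, a4, -⟩ | ⟨a0, a1, m, -, a2, a3, a4⟩ |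
    ⟨a0, a1, m, -, a2, a3, a4⟩ <;>
  rcases h₁.point hβ hi hu₁ hq₁ hr₁ with ⟨b1, b2, b3, b4, -⟩ | ⟨b0, b1, m₁, -, b2, b3, b4⟩ |
    ⟨b0, b1, m₁, -, b2, b3, b4⟩
  · exact ⟨add_right_cancel (a1.symm.trans b1), a2.trans b2.symm⟩
  · rcases hc with ⟨-, c, -⟩ | ⟨c, -⟩
    · exact absurd (c.mpr b3) a3.ne'
    · exact absurd b0 c
  · rcases hc with ⟨c, -⟩ | ⟨-, c, -⟩
    · exact absurd b0 c
    · exact absurd (c.mpr b3) a4.ne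
  · rcases hc with ⟨-, c, -⟩ | ⟨c, -⟩
    · exact absurd (c.mp a3) b3.ne'
    · exact absurd a0 c
  · rcases hc with ⟨-, -, c⟩ | ⟨c, -⟩
    · have := c a3
      rw [a4, b4] at this
      exact ⟨a1.trans b1.symm, by rw [a2, b2, cast_eq this]⟩
    · exact absurd a0 c
  · exact absurd (a0.symm.trans b0) (by decide)
  · rcases hc with ⟨c, -⟩ | ⟨-, c, -⟩
    · exact absurd a0 c
    · exact absurd (c.mp a3) b4.ne
  · exact absurd (a0.symm.trans b0) (by decide)
  · rcases hc with ⟨c, -⟩ | ⟨-, -, c⟩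
    · exact absurd a0 c
    · have := c a3
      rw [a4, b4] at this
      exact ⟨a1.trans b1.symm, by rw [a2, b2, cast_eq this]⟩

/-- Different pieces of the same face do not overlap. -/
theorem IsPiece.unique {U V V₁ : Face 5 2} {q r u u' u₁ u₁' : ℝ} {k l k₁ l₁ : Fin 5}
    {o o' o₁ o₁' : Fin 5 → ℤ} (h : IsPiece t β U V q r k l o o' u u')
    (h₁ : IsPiece t β U V₁ q r k₁ l₁ o₁ o₁' u₁ u₁') : V = V₁ := by
  obtain ⟨hkl, ht, h1, h2, hM, hu, hu', hqe, hre⟩ := h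
  obtain ⟨hkl₁, ht₁, h1₁, h2₁, hM₁, hu₁, hu₁', hqe₁, hre₁⟩ := h₁
  suffices hs : (k = k₁ ∧ o = o₁) ∧ l = l₁ ∧ o' = o₁' by
    obtain ⟨⟨rfl, rfl⟩, rfl, rfl⟩ := hs
    exact Prod.ext (sigmaFam_mulVec_injective t (hM.trans hM₁.symm))
      (Subtype.ext (ht.trans ht₁.symm))
  clear hM hM₁ ht ht₁
  have hij := U.2.letters_lt (show (0 : Fin 2) < 1 by decide)
  generalize U.2.letters 0 = i at *
  generalize U.2.letters 1 = j at *
  have hj : j ≠ 0 := (lt_of_le_of_lt (Fin.zero_le _) hij).ne'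
  rcases eq_or_ne i 0 with hi | hi
  · obtain ⟨rfl, rfl⟩ := h1.of_zero hi
    obtain ⟨rfl, rfl⟩ := h1₁.of_zero hi
    obtain ⟨hl, rfl⟩ := h2.of_ne hkl.symm
    obtain ⟨hl₁, rfl⟩ := h2₁.of_ne hkl₁.symm
    exact ⟨⟨rfl, rfl⟩, add_right_cancel (hl.symm.trans hl₁), rfl⟩
  · have hwi := width_pos hβ hi
    have hwj := width_pos hβ hj
    have hi4 : i ≠ 4 := by
      rintro rfl
      exact (by decide : ∀ j : Fin 5, ¬ 4 < j) j hij
    have hj1 : j ≠ 1 := by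
      rintro rfl
      exact hi ((by decide : ∀ i : Fin 5, i < 1 → i = 0) i hij)
    have hdi : drop t i = 0 := by fin_cases i <;> simp [drop] at hi4 ⊢
    have hlj : lift t j = 0 := by fin_cases j <;> simp [lift] at hj1 ⊢
    have local_coord : ∀ (k : Fin 5) (o : Fin 5 → ℤ) (u : ℝ) (i : Fin 5), ∃ q r : ℝ,
        q = planeX β (toReal o + u • (sigmaFam t).action (Pi.single k 1) - toReal (leftEnd i)) ∧
        r = planeY β (toReal o + u • (sigmaFam t).action (Pi.single k 1) - toReal (leftEnd i)) :=
      fun k o u i => ⟨_, _, rfl, rfl⟩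
    obtain ⟨q₁, r₁, hq₁, hr₁⟩ := local_coord k o u i
    obtain ⟨q₂, r₂, hq₂, hr₂⟩ := local_coord l o' u' j
    obtain ⟨q₃, r₃, hq₃, hr₃⟩ := local_coord k₁ o₁ u₁ i
    obtain ⟨q₄, r₄, hq₄, hr₄⟩ := local_coord l₁ o₁' u₁' j
    have d1 := h1.onDeformed hβ hi hu hq₁ hr₁
    have d2 := h2.onDeformed hβ hj hu' hq₂ hr₂
    have d3 := h1₁.onDeformed hβ hi hu₁ hq₃ hr₃
    have d4 := h2₁.onDeformed hβ hj hu₁' hq₄ hr₄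
    have eq : q₁ + q₂ = q₃ + q₄ := by
      have := hqe.symm.trans hqe₁
      rw [map_add, map_add, map_add (planeX β) _ (_ + _), map_add (planeX β) (toReal U.1)] at this
      rw [hq₁, hq₂, hq₃, hq₄, map_sub, map_sub, map_sub, map_sub]
      linarith
    have er : r₁ + r₂ = r₃ + r₄ := by
      have := hre.symm.trans hre₁
      rw [map_add, map_add, map_add (planeY β) _ (_ + _), map_add (planeY β) (toReal U.1)] at this
      rw [hr₁, hr₂, hr₃, hr₄, map_sub, map_sub, map_sub, map_sub]
      linarith
    obtain ⟨c1, c2, c3, c4⟩ := deformed_injective (slope_lt hβ hi hij) hwi hwj hdi hlj d1.1 d2.1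
      (by
        by_cases hk : k = 4
        · exact Or.inr (d2.2 fun hl => hkl (hk.trans hl.symm))
        · exact Or.inl (d1.2 hk)) d3.1 d4.1
      (by
        by_cases hk : k₁ = 4
        · exact Or.inr (d4.2 fun hl => hkl₁ (hk.trans hl.symm))
        · exact Or.inl (d3.2 hk)) eq er
    exact ⟨h1.unique hβ h1₁ hi hu hu₁ hq₁ hr₁ hq₃ hr₃ (Or.inl ⟨hi4, c1, c3⟩),
      h2.unique hβ h2₁ hj hu' hu₁' hq₂ hr₂ hq₄ hr₄ (Or.inr ⟨hj1, c2, c4⟩)⟩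

/-- The heights of the vertices of the faces near to the contracting space. -/
theorem height_vertex {U : Face 5 2}
    (hU : U ∈ facesNear hβ.isPrimitiveUnitPisot (rfl : 3 + 2 = 5)) {p : Fin 5 → ℤ}
    (hp : U.IsVertex p) : 0 ≤ height β (toReal p) ∧ height β (toReal p) < totalHeight β := by
  obtain ⟨D, ⟨s, ⟨hs0, hs1⟩, hs⟩, hmem⟩ := hU
  have hb := hβ.pos
  have hUD : U = (D.1 + D.2.vec, D.2.compl (rfl : 3 + 2 = 5)) := by
    by_contra hne
    rw [Finsupp.mem_support_iff, poincare_apply, Finsupp.single_apply, if_neg, mul_zero] at hmem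
    · exact hmem rfl
    · intro h
      apply hne
      rw [h]
      simp [Face.transverse, WedgeType.compl_compl]
  have hpos : ∀ a : Fin 5, 0 < height β (Pi.single a 1) := by
    intro a
    rw [height_apply]
    fin_cases a <;> simp <;> positivity
  have hvec : ∀ {k : ℕ} (a : WedgeType 5 k),
      height β (toReal a.vec) = ∑ i ∈ a.1, height β (Pi.single i 1) := by
    intro k a
    have : toReal a.vec = ∑ i ∈ a.1, Pi.single i 1 := by
      ext m
      simp [toReal, WedgeType.vec, Finset.sum_apply, Pi.single_apply]
    rw [this, map_sum]
  have hsegment : height β (toReal D.1) = -(1 - s) * height β (toReal D.2.vec) := by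
    have h1 := congrArg (fun w : Ke (sigmaFam t) β => height β w) hs
    simp only [smul_zero, add_zero] at h1
    rw [hβ.height_piE] at h1
    change height β (toReal D.1) = _ at h1
    rw [h1]
    simp only [Submodule.coe_smul, Submodule.coe_neg, map_smul, map_neg, smul_eq_mul]
    rw [hβ.height_piE]
    change (1 - s) * -height β (toReal D.2.vec) = _
    ring
  have hvpos : 0 < height β (toReal D.2.vec) := by
    rw [hvec]
    refine Finset.sum_pos (fun i _ => hpos i) ?_
    rw [← Finset.card_pos, D.2.2]
    norm_num
  -- The base point of U has height in [0, h), where h is the height of the letters of D; the edges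
  -- of U use the complementary letters, so every vertex stays below the total.
  have htotal : height β (toReal D.2.vec) + (height β (Pi.single (U.2.letters 0) 1) +
      height β (Pi.single (U.2.letters 1) 1)) = totalHeight β := by
    have h2 : height β (Pi.single (U.2.letters 0) 1) + height β (Pi.single (U.2.letters 1) 1) =
        ∑ i ∈ U.2.1, height β (Pi.single i 1) := by
      rw [← hvec, WedgeType.vec_eq, Fin.sum_univ_two, toReal_add, toReal_single, toReal_single,
        map_add]
    rw [h2, hvec, hUD]
    have := Finset.sum_add_sum_compl D.2.1 (fun i => height β (Pi.single i 1))
    refine this.trans ?_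
    simp only [Fin.sum_univ_five, height_apply, totalHeight]
    simp
    field_simp
    ring
  obtain ⟨ε, ε', hε, hε', rfl⟩ := hp
  have hb0 : ∀ a (ε : ℤ), (ε = 0 ∨ ε = 1) → 0 ≤ ε * height β (Pi.single a 1) ∧
      ε * height β (Pi.single a 1) ≤ height β (Pi.single a 1) := by
    rintro a ε (rfl | rfl)
    · simpa using (hpos a).le
    · simpa using (hpos a).le
  have h3 := hb0 (U.2.letters 0) ε hε
  have h4 := hb0 (U.2.letters 1) ε' hε'
  have h5 : height β (toReal U.1) = s * height β (toReal D.2.vec) := by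
    rw [hUD]
    simp only [toReal_add, map_add, hsegment]
    ring
  have h6 : s * height β (toReal D.2.vec) < height β (toReal D.2.vec) :=
    mul_lt_of_lt_one_left hvpos hs1
  have h7 : 0 ≤ s * height β (toReal D.2.vec) := mul_nonneg hs0 hvpos.le
  rw [toReal_add, toReal_add, toReal_smul, toReal_smul, toReal_single, toReal_single, map_add,
    map_add, map_smul, map_smul, smul_eq_mul, smul_eq_mul, h5]
  constructor <;> linarith

omit hβ in
-- All three forms vanish on the neutral space, so a lattice point enters only through three
-- integers.
theorem lattice_coordinates (β : ℝ) (hb : 0 < β) (d : Fin 5 → ℤ) :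
    ∃ a b c : ℤ, planeX β (toReal d) = c - b / β ∧ planeY β (toReal d) = a - (β + 1) * b ∧
      height β (toReal d) = β * a + b / (β + 1) + c := by
  refine ⟨d 0 + d 3, d 1 - d 2 + d 3, d 4 + d 2 - d 3, ?_, ?_, ?_⟩
  · rw [planeX_apply]; simp [toReal]; ring
  · rw [planeY_apply]; simp [toReal]; ring
  · rw [height_apply]; simp [toReal]; field_simp; ring

/-- The order of edges of faces near to the contracting space is preserved by the deformation. -/
theorem deformed_mono {U₁ U₂ : Face 5 2}
    (hU₁ : U₁ ∈ facesNear hβ.isPrimitiveUnitPisot (rfl : 3 + 2 = 5))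
    (hU₂ : U₂ ∈ facesNear hβ.isPrimitiveUnitPisot (rfl : 3 + 2 = 5))
    {p₁ p₂ : Fin 5 → ℤ} {i₁ i₂ : Fin 5} {q m n : ℝ} (h₁ : U₁.HasEdge β p₁ i₁ q)
    (h₂ : U₂.HasEdge β p₂ i₂ q)
    (hv₁ : ∀ p, U₁.IsVertex p → m * planeX β (toReal p) + n ≤ planeY β (toReal p))
    (hv₂ : ∀ p, U₂.IsVertex p → planeY β (toReal p) ≤ m * planeX β (toReal p) + n) :
    deformed t β p₂ i₂ q ≤ deformed t β p₁ i₁ q := by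
  have hb := hβ.pos
  have xi : ∀ p m, planeX β (toReal (p + edgeVec m)) = planeX β (toReal p) + width β m := by
    intro p m; rw [toReal_add, map_add, planeX_edgeVec]
  have yi : ∀ p m, planeY β (toReal (p + edgeVec m)) = planeY β (toReal p) + rise β m := by
    intro p m; rw [toReal_add, map_add, planeY_edgeVec]
  have e1 := hv₁ _ h₁.right
  have e2 := hv₂ _ h₂.right
  rw [xi, yi] at e1 e2
  refine deformed_le_deformed hβ h₁.ne h₂.ne (hv₁ _ h₁.left) e1 (hv₂ _ h₂.left) e2 h₁.lt h₁.gt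
    h₂.lt h₂.gt ?_ ?_
  · rintro rfl k1 k2 k3 k4
    obtain ⟨a, b, c, l1, l2, l3⟩ := lattice_coordinates β hb (p₁ - p₂)
    have t1 := height_vertex hβ hU₁ h₁.left
    have t2 := height_vertex hβ hU₂ h₂.left
    have t3 := height_vertex hβ hU₂ h₂.right
    -- The right end of the lower edge has height one more than its left end, which improves the
    -- bound for the left end by 1; the case b = -1 of `no_lattice_point_left` needs this.
    have t4 : height β (toReal (edgeVec 4)) = 1 := by
      rw [edgeVec, toReal_smul, toReal_single, height_apply]; simp [leftward]
    rw [toReal_add, map_add, t4] at t3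
    rw [toReal_sub, map_sub] at l1 l2 l3
    have t5 := t3.2
    rw [totalHeight] at t5
    refine no_lattice_point_left hβ (a := a) (b := b) (c := c) ?_ ?_ ?_ ?_ ?_ ?_
    · rw [← l1]; linarith
    · rw [← l1]; linarith
    · rw [← l2]; linarith
    · rw [← l1, ← l2]; linarith
    · rw [← l3]; linarith
    · rw [← l3]; linarith
  · rintro rfl u hu k1 k2 k3 k4
    obtain ⟨a, b, c, l1, l2, l3⟩ :=
      lattice_coordinates β hb (p₁ + edgeVec i₁ - (p₂ + edgeVec 1))
    have t1 := height_vertex hβ hU₁ h₁.right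
    have t2 := height_vertex hβ hU₂ h₂.right
    rw [toReal_sub, map_sub] at l1 l2 l3
    rw [xi, xi] at l1
    rw [yi, yi] at l2
    refine no_lattice_point_right hβ (a := a) (b := b) (c := c) (u := u) ?_ k1 k2 ?_ ?_ ?_ ?_
    · rw [← l1, hu]; ring
    · rw [← l2]; linarith
    · rw [← l2]; linarith
    · rw [← l3]; linarith
    · rw [← l3]; linarith

end

/-! ### Non-overlapping images and the conclusion -/

section

variable {t : ℕ} {β : ℝ} (hβ : IsDominantRoot t β)
include hβ

theorem not_disjoint_interior_self (V : Face 5 2) :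
    ¬ Disjoint (interior (hβ.isPrimitiveUnitPisot.piC '' V.support))
      (interior (hβ.isPrimitiveUnitPisot.piC '' V.support)) := by
  rw [disjoint_self, hβ.interior_piC_support]
  refine Set.Nonempty.ne_empty ⟨_, ⟨(1 / 2, 1 / 2), ?_, rfl⟩⟩
  constructor <;> constructor <;> norm_num

/-- The images under `M` of overlapping faces `V₁` and `V₂` of the images of `U₁` and `U₂`. -/
theorem exists_isPiece_of_not_disjoint {U₁ U₂ V₁ V₂ : Face 5 2}
    (h₁ : V₁ ∈ (geometricDual (sigmaFam t) (rfl : 3 + 2 = 5) U₁.toChain).support)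
    (h₂ : V₂ ∈ (geometricDual (sigmaFam t) (rfl : 3 + 2 = 5) U₂.toChain).support)
    (h : ¬ Disjoint (interior (hβ.isPrimitiveUnitPisot.piC '' V₁.support))
      (interior (hβ.isPrimitiveUnitPisot.piC '' V₂.support))) :
    ∃ q r : ℝ, (∀ y, planeX β (toReal y) ≠ q) ∧
      (∃ k l o o' u u', IsPiece t β U₁ V₁ q r k l o o' u u') ∧
      ∃ k l o o' u u', IsPiece t β U₂ V₂ q r k l o o' u u' := by
  obtain ⟨s, hs, s', hs', u, hu, u', hu', e1, e2, hgen⟩ := hβ.exists_point_of_not_disjoint h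
  have p₁ := exists_isPiece β (precedes_of_mem_support h₁) hs hs'
  have p₂ := exists_isPiece β (precedes_of_mem_support h₂) hu hu'
  rw [hβ.planeX_action, hβ.planeY_action, ← e1, ← e2, ← hβ.planeX_action, ← hβ.planeY_action] at p₂
  exact ⟨_, _, hgen, p₁, p₂⟩

theorem projectsWell_geometricDual (U : Face 5 2) :
    ProjectsWell hβ.isPrimitiveUnitPisot
      (geometricDual (sigmaFam t) (rfl : 3 + 2 = 5) U.toChain) := by
  refine ⟨isGeometric_geometricDual t U, fun V hV V' hV' hne => ?_⟩
  by_contra h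
  obtain ⟨q, r, -, ⟨k, l, o, o', u, u', p⟩, k', l', o₁, o₁', v, v', p'⟩ :=
    exists_isPiece_of_not_disjoint hβ hV hV' h
  exact hne (p.unique hβ p')

omit hβ in
theorem Face.IsVertex.exists_point {U : Face 5 2} {p : Fin 5 → ℤ} (hp : U.IsVertex p) :
    ∃ s ∈ Set.Icc (0 : ℝ) 1, ∃ s' ∈ Set.Icc (0 : ℝ) 1, toReal p = U.point s s' := by
  obtain ⟨ε, ε', hε, hε', rfl⟩ := hp
  refine ⟨ε, ?_, ε', ?_, ?_⟩
  · rcases hε with rfl | rfl <;> simp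
  · rcases hε' with rfl | rfl <;> simp
  · rw [toReal_add, toReal_add, toReal_smul, toReal_smul, toReal_single, toReal_single]; rfl

/-- The images of faces near to the contracting space that do not overlap do not overlap. -/
theorem disjoint_interior_of_mem_support {U₁ U₂ V₁ V₂ : Face 5 2}
    (hU₁ : U₁ ∈ facesNear hβ.isPrimitiveUnitPisot (rfl : 3 + 2 = 5))
    (hU₂ : U₂ ∈ facesNear hβ.isPrimitiveUnitPisot (rfl : 3 + 2 = 5))
    (hU : Disjoint (interior (hβ.isPrimitiveUnitPisot.piC '' U₁.support))
      (interior (hβ.isPrimitiveUnitPisot.piC '' U₂.support)))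
    (h₁ : V₁ ∈ (geometricDual (sigmaFam t) (rfl : 3 + 2 = 5) U₁.toChain).support)
    (h₂ : V₂ ∈ (geometricDual (sigmaFam t) (rfl : 3 + 2 = 5) U₂.toChain).support) :
    Disjoint (interior (hβ.isPrimitiveUnitPisot.piC '' V₁.support))
      (interior (hβ.isPrimitiveUnitPisot.piC '' V₂.support)) := by
  by_contra h
  obtain ⟨q, r, hq, ⟨k, l, o, o', u, u', P₁⟩, k', l', o₁, o₁', v, v', P₂⟩ :=
    exists_isPiece_of_not_disjoint hβ h₁ h₂ h
  obtain ⟨⟨p₁, i₁, b₁, r₁⟩, p₁', i₁', c₁, r₁'⟩ := P₁.exists_edges hβ hq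
  obtain ⟨⟨p₂, i₂, b₂, r₂⟩, p₂', i₂', c₂, r₂'⟩ := P₂.exists_edges hβ hq
  obtain ⟨κ, μ, c, hne, hle, hge⟩ := hβ.exists_separating_line hU
  have v₁ : ∀ p, U₁.IsVertex p → κ * planeX β (toReal p) + μ * planeY β (toReal p) ≤ c := by
    intro p hp
    obtain ⟨s, hs, s', hs', e⟩ := hp.exists_point
    rw [e]
    exact hle s hs s' hs'
  have v₂ : ∀ p, U₂.IsVertex p → c ≤ κ * planeX β (toReal p) + μ * planeY β (toReal p) := by
    intro p hp
    obtain ⟨s, hs, s', hs', e⟩ := hp.exists_point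
    rw [e]
    exact hge s hs s' hs'
  have xi : ∀ p m, planeX β (toReal (p + edgeVec m)) = planeX β (toReal p) + width β m := by
    intro p m; rw [toReal_add, map_add, planeX_edgeVec]
  -- The sign of μ tells which face is above the line. The line is not vertical, because both faces
  -- have an edge over the same q.
  rcases lt_trichotomy μ 0 with hμ | rfl | hμ
  · have key : ∀ x y : ℝ, -κ / μ * x + c / μ = (c - κ * x) / μ := by intro x _; ring
    have := deformed_mono hβ hU₁ hU₂ b₁ c₂ (m := -κ / μ) (n := c / μ)
      (fun p hp => by
        rw [key _ 0, div_le_iff_of_neg hμ]; linarith [v₁ p hp])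
      (fun p hp => by
        rw [key _ 0, le_div_iff_of_neg hμ]; linarith [v₂ p hp])
    linarith
  · have hκ : κ ≠ 0 := hne.resolve_right (not_not.mpr rfl)
    have w1 := v₁ _ b₁.left
    have w2 := v₁ _ b₁.right
    have w3 := v₂ _ b₂.left
    have w4 := v₂ _ b₂.right
    rw [xi] at w2 w4
    have g1 := b₁.lt
    have g2 := b₁.gt
    have g3 := b₂.lt
    have g4 := b₂.gt
    rcases lt_or_gt_of_ne hκ with hκ | hκ
    · have := mul_lt_mul_of_neg_left g1 hκ
      have := mul_lt_mul_of_neg_left g4 hκ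
      linarith
    · have := mul_lt_mul_of_pos_left g2 hκ
      have := mul_lt_mul_of_pos_left g3 hκ
      linarith
  · have key : ∀ x y : ℝ, -κ / μ * x + c / μ = (c - κ * x) / μ := by intro x _; ring
    have := deformed_mono hβ hU₂ hU₁ b₂ c₁ (m := -κ / μ) (n := c / μ)
      (fun p hp => by
        rw [key _ 0, div_le_iff₀ hμ]; linarith [v₂ p hp])
      (fun p hp => by
        rw [key _ 0, le_div_iff₀ hμ]; linarith [v₁ p hp])
    linarith

omit hβ in
theorem ProjectsWell.add {n k : ℕ} {σ : Substitution n} {h : σ.IsPrimitiveUnitPisot β}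
    {P Q : Chain n k} (hP : ProjectsWell h P) (hQ : ProjectsWell h Q)
    (hPQ : Disjoint P.support Q.support)
    (hd : ∀ F ∈ P.support, ∀ G ∈ Q.support,
      Disjoint (interior (h.piC '' F.support)) (interior (h.piC '' G.support))) :
    ProjectsWell h (P + Q) := by
  classical
  constructor
  · intro F hF
    rcases Finset.mem_union.mp (Finsupp.support_add hF) with hF | hF
    · rw [Finsupp.add_apply, Finsupp.notMem_support_iff.mp (Finset.disjoint_left.mp hPQ hF),
        add_zero]
      exact hP.1 F hF
    · rw [Finsupp.add_apply, Finsupp.notMem_support_iff.mp (Finset.disjoint_right.mp hPQ hF),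
        zero_add]
      exact hQ.1 F hF
  · intro F hF G hG hne
    rcases Finset.mem_union.mp (Finsupp.support_add hF) with hF | hF <;>
      rcases Finset.mem_union.mp (Finsupp.support_add hG) with hG | hG
    · exact hP.2 F hF G hG hne
    · exact hd F hF G hG
    · exact (hd G hG F hF).symm
    · exact hQ.2 F hF G hG hne

theorem disjoint_interior_of_projectsWell {U₁ U₂ : Face 5 2} (hne : U₁ ≠ U₂)
    (h : ProjectsWell hβ.isPrimitiveUnitPisot (U₁.toChain + U₂.toChain)) :
    Disjoint (interior (hβ.isPrimitiveUnitPisot.piC '' U₁.support))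
      (interior (hβ.isPrimitiveUnitPisot.piC '' U₂.support)) := by
  refine h.2 U₁ ?_ U₂ ?_ hne
  · rw [Finsupp.mem_support_iff, Finsupp.add_apply, Face.toChain, Face.toChain,
      Finsupp.single_eq_same, Finsupp.single_eq_of_ne hne]
    norm_num
  · rw [Finsupp.mem_support_iff, Finsupp.add_apply, Face.toChain, Face.toChain,
      Finsupp.single_eq_same, Finsupp.single_eq_of_ne hne.symm]
    norm_num

theorem isNiceReducible :
    IsNiceReducible hβ.isPrimitiveUnitPisot (rfl : 3 + 2 = 5) where
  degree := by rw [hβ.minpoly_eq, pisotPoly_natDegree]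
  S1 U _ := ⟨isGeometric_geometricDual t U, projectsWell_geometricDual hβ U⟩
  S2 U₁ hU₁ U₂ hU₂ hne h := by
    have hU := disjoint_interior_of_projectsWell hβ hne h
    have hV : Disjoint (geometricDual (sigmaFam t) (rfl : 3 + 2 = 5) U₁.toChain).support
        (geometricDual (sigmaFam t) (rfl : 3 + 2 = 5) U₂.toChain).support :=
      -- A face common to both images would overlap itself, as its projection has nonempty interior.
      Finset.disjoint_left.mpr fun V h₁ h₂ => not_disjoint_interior_self hβ V
        (disjoint_interior_of_mem_support hβ hU₁ hU₂ hU h₁ h₂)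
    refine ⟨hV, ?_⟩
    rw [map_add]
    exact (projectsWell_geometricDual hβ U₁).add (projectsWell_geometricDual hβ U₂) hV
      fun V₁ h₁ V₂ h₂ => disjoint_interior_of_mem_support hβ hU₁ hU₂ hU h₁ h₂
  P := ⟨dualExtension_nonneg t, dualMatrix_isPrimitive t⟩
  N := hβ.neutral_condition

end

end PisotDual

/-- For every `t`, the substitution `σ_t` on five letters is a reducible primitive unit Pisot
substitution with Pisot root of degree `3`, and it is a nice reducible substitution. -/
theorem mainTheorem8 (t : ℕ) :
    ∃ (β : ℝ) (h : (PisotDual.sigmaFam t).IsPrimitiveUnitPisot β),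
      PisotDual.IsReducible (PisotDual.sigmaFam t) β ∧
        PisotDual.IsNiceReducible h (rfl : 3 + 2 = 5) := by
  obtain ⟨β, hβ⟩ := PisotDual.exists_isDominantRoot t
  exact ⟨β, hβ.isPrimitiveUnitPisot, hβ.isReducible, PisotDual.isNiceReducible hβ⟩
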